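/- Let $n \ge 2$, let $\Omega \subseteq \mathbb{R}^n$ be open, let $p \ge 2$ be real, and for $\gamma > 0$ put $$H_\gamma(\xi) = (|\xi|-1)_+^{\gamma}\,\frac{\xi}{|\xi|} \quad (\xi \in \mathbb{R}^n \setminus \{0\}), \qquad H_\gamma(0) = 0 .$$ Let $f : \Omega \times \mathbb{R} \to \mathbb{R}$ be such that for every open set $\Omega' \Subset \Omega$ (that is, $\overline{\Omega'}$ is compact and contained in $\Omega$) and every $K > 0$ there are constants $L, M > 0$ with $$|f(x,s)-f(x,t)| \le L\,|s-t| \quad\text{(F1)}, \qquad |f(x,s)-f(y,s)| \le M\,|x-y| \quad\text{(F2)}$$ for all $x, y \in \Omega'$ and all real $s,t$ with $|s|,|t| \le K$. Let $u \in W^{1,p}_{loc}(\Omega) \cap L^\infty_{loc}(\Omega)$ be a local weak solution of the widely degenerate equation $$-\operatorname{div}\Big( (|Du|-1)_+^{p-1} \frac{Du}{|Du|} \Big) = f(x,u) \quad \text{in } \Omega,$$ that is, for every open set $\widetilde\Omega \Subset \Omega$ and every $\varphi \in W^{1,p}_0(\widetilde\Omega)$ (extended by zero), $$\int_\Omega \langle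 H_{p-1}(Du), D\varphi\rangle \, dx = \int_\Omega f(x,u)\,\varphi \, dx .$$ Then $$H_{p/2}(Du) = (|Du|-1)_+^{p/2} \frac{Du}{|Du|} \in W^{1,2}_{loc}(\Omega;\mathbb{R}^n).$$ -/

import Mathlib

open MeasureTheory Filter Topology
open scoped ContDiff Gradient

namespace WidelyDegenerate

/-- `U ⋐ Ω`: the set `U` is open and its closure is compact and contained in `Ω`. -/
def CompactlyIncluded {n : ℕ} (U Ω : Set (EuclideanSpace ℝ (Fin n))) : Prop :=
  IsOpen U ∧ IsCompact (closure U) ∧ closure U ⊆ Ω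

/-- `C_c^∞(Ω)`: smooth real functions with compact support contained in `Ω`. -/
def IsTestFunction {n : ℕ} (Ω : Set (EuclideanSpace ℝ (Fin n)))
    (φ : EuclideanSpace ℝ (Fin n) → ℝ) : Prop :=
  ContDiff ℝ ∞ φ ∧ HasCompactSupport φ ∧ tsupport φ ⊆ Ω

/-- `L^q_loc(Ω; V)`: the functions which are in `L^q(U)` for every open `U ⋐ Ω`. -/
def MemLpLoc {n : ℕ} {V : Type*} [NormedAddCommGroup V] (Ω : Set (EuclideanSpace ℝ (Fin n)))
    (q : ENNReal) (g : EuclideanSpace ℝ (Fin n) → V) : Prop :=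
  ∀ U : Set (EuclideanSpace ℝ (Fin n)), CompactlyIncluded U Ω → MemLp g q (volume.restrict U)

/-- `G` is a weak (distributional) gradient of the real function `u` in `Ω`:
both are locally integrable in `Ω` and `∫ u ∂ᵢφ = - ∫ Gᵢ φ` for all `φ ∈ C_c^∞(Ω)` and all `i`. -/
structure IsWeakGradient {n : ℕ} (Ω : Set (EuclideanSpace ℝ (Fin n)))
    (u : EuclideanSpace ℝ (Fin n) → ℝ)
    (G : EuclideanSpace ℝ (Fin n) → EuclideanSpace ℝ (Fin n)) : Prop where
  locallyIntegrable : LocallyIntegrableOn u Ω volume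
  locallyIntegrable_gradient : LocallyIntegrableOn G Ω volume
  integral_eq : ∀ φ : EuclideanSpace ℝ (Fin n) → ℝ, IsTestFunction Ω φ → ∀ i : Fin n,
    ∫ x in Ω, u x * ∇ φ x i = - ∫ x in Ω, G x i * φ x

/-- `u ∈ W^{1,q}_loc(Ω)`, and `Du` is (a representative of) its weak gradient. -/
structure HasSobolevGradientLoc {n : ℕ} (Ω : Set (EuclideanSpace ℝ (Fin n))) (q : ENNReal)
    (u : EuclideanSpace ℝ (Fin n) → ℝ)
    (Du : EuclideanSpace ℝ (Fin n) → EuclideanSpace ℝ (Fin n)) : Prop where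
  isWeakGradient : IsWeakGradient Ω u Du
  memLpLoc : MemLpLoc Ω q u
  memLpLoc_gradient : MemLpLoc Ω q Du

/-- `F ∈ W^{1,q}_loc(Ω; ℝ^m)`: every component of `F` lies in `W^{1,q}_loc(Ω)`. -/
def MemW1Loc {n m : ℕ} (Ω : Set (EuclideanSpace ℝ (Fin n))) (q : ENNReal)
    (F : EuclideanSpace ℝ (Fin n) → EuclideanSpace ℝ (Fin m)) : Prop :=
  ∀ j : Fin m, ∃ G : EuclideanSpace ℝ (Fin n) → EuclideanSpace ℝ (Fin n),
    HasSobolevGradientLoc Ω q (fun x => F x j) G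

/-- `φ ∈ W^{1,q}_0(U)` with weak gradient `Dφ`, both extended by zero outside `U`:
`(φ, Dφ)` is the limit in `L^q` of `(ψ k, ∇ (ψ k))` for a sequence `ψ k` in `C_c^∞(U)`.
The norms are over the whole space, so that `φ` and `Dφ` vanish a.e. outside `U`. -/
structure HasSobolevGradientZero {n : ℕ} (U : Set (EuclideanSpace ℝ (Fin n))) (q : ENNReal)
    (φ : EuclideanSpace ℝ (Fin n) → ℝ)
    (Dφ : EuclideanSpace ℝ (Fin n) → EuclideanSpace ℝ (Fin n)) : Prop where
  memLp : MemLp φ q volume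
  memLp_gradient : MemLp Dφ q volume
  exists_approx : ∃ ψ : ℕ → EuclideanSpace ℝ (Fin n) → ℝ, (∀ k, IsTestFunction U (ψ k)) ∧
    Tendsto (fun k => eLpNorm (fun x => ψ k x - φ x) q volume) atTop (𝓝 0) ∧
    Tendsto (fun k => eLpNorm (fun x => ∇ (ψ k) x - Dφ x) q volume) atTop (𝓝 0)

/-- `H_γ(ξ) = (|ξ| - 1)_+^γ ξ / |ξ|`, with the value `0` at `ξ = 0`. -/
noncomputable def H {n : ℕ} (γ : ℝ) (ξ : EuclideanSpace ℝ (Fin n)) : EuclideanSpace ℝ (Fin n) :=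
  (max (‖ξ‖ - 1) 0) ^ γ • (‖ξ‖⁻¹ • ξ)

/-- `u ∈ W^{1,p}_loc(Ω)`, with weak gradient `Du`, is a local weak solution of
`- div ((|Du| - 1)_+^{p-1} Du / |Du|) = f(x, u)` in `Ω`. -/
def IsLocalWeakSolution {n : ℕ} (Ω : Set (EuclideanSpace ℝ (Fin n))) (p : ℝ)
    (f : EuclideanSpace ℝ (Fin n) → ℝ → ℝ) (u : EuclideanSpace ℝ (Fin n) → ℝ)
    (Du : EuclideanSpace ℝ (Fin n) → EuclideanSpace ℝ (Fin n)) : Prop :=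
  HasSobolevGradientLoc Ω (ENNReal.ofReal p) u Du ∧
  ∀ U : Set (EuclideanSpace ℝ (Fin n)), CompactlyIncluded U Ω →
    ∀ (φ : EuclideanSpace ℝ (Fin n) → ℝ)
      (Dφ : EuclideanSpace ℝ (Fin n) → EuclideanSpace ℝ (Fin n)),
      HasSobolevGradientZero U (ENNReal.ofReal p) φ Dφ →
      ∫ x in Ω, inner ℝ (H (p - 1) (Du x)) (Dφ x) = ∫ x in Ω, f x (u x) * φ x

/-- (F1): `f` is Lipschitz in the second variable, locally uniformly. -/
def ConditionF1 {n : ℕ} (Ω : Set (EuclideanSpace ℝ (Fin n)))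
    (f : EuclideanSpace ℝ (Fin n) → ℝ → ℝ) : Prop :=
  ∀ U : Set (EuclideanSpace ℝ (Fin n)), CompactlyIncluded U Ω → ∀ K : ℝ, 0 < K →
    ∃ L : ℝ, 0 < L ∧ ∀ x ∈ U, ∀ s t : ℝ, |s| ≤ K → |t| ≤ K →
      |f x s - f x t| ≤ L * |s - t|

/-- (F2): `f` is Lipschitz in the first variable, locally uniformly. -/
def ConditionF2 {n : ℕ} (Ω : Set (EuclideanSpace ℝ (Fin n)))
    (f : EuclideanSpace ℝ (Fin n) → ℝ → ℝ) : Prop :=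
  ∀ U : Set (EuclideanSpace ℝ (Fin n)), CompactlyIncluded U Ω → ∀ K : ℝ, 0 < K →
    ∃ M : ℝ, 0 < M ∧ ∀ x ∈ U, ∀ y ∈ U, ∀ s : ℝ, |s| ≤ K →
      |f x s - f y s| ≤ M * ‖x - y‖

end WidelyDegenerate

namespace WidelyDegenerate

/-! The proof is Nirenberg's difference quotient method, with all differences of `Du` measured
through `H (p / 2)`. The equation degenerates on the whole unit ball, so nothing controls `Du`
itself; what survives is the monotonicity estimate |H_{p/2}(ξ) - H_{p/2}(ζ)|² ≤ (p²/2) ⟨H_{p-1}(ξ) -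
H_{p-1}(ζ), ξ - ζ⟩ (`norm_H_sub_sq_le`). It holds because ξ - H_1(ξ) is the projection of ξ onto the
closed unit ball and H_γ(ξ) is an outward normal there, so ξ - ζ may be replaced by H_1(ξ) - H_1(ζ);
the other H_γ involved are power maps of H_1. In the opposite direction, `norm_H_sub_le` bounds
differences of the flux H_{p-1} by those of H_{p/2}, with a weight of growth p/2 - 1.

Near a compact set, u is replaced by a cut-off g defined on the whole space, with gradient G, and
f(x, u) by a globally Lipschitz F(x, g); this is where local boundedness of u and (F1), (F2) enter.
Let d(x) = g(x + v) - g(x). Subtracting the equation from its translate and testing with η²d, the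
cross term from ∇η is absorbed by Young's inequality (`sq_mul_norm_H_sub_sq_le`). The remaining
terms are of order |v|², since d/|v| is bounded in L^p by |G| and the right-hand side changes by at
most L(|v| + |d|). Hence ∫ η² |H_{p/2}(G(x + v)) - H_{p/2}(G(x))|² ≤ C|v|²
(`exists_integral_sq_H_translate_sub_le`).

This makes φ ↦ ∫ w ∂ᵢφ bounded in the L² norm for each component w of H_{p/2}(Du), and Riesz
representation gives a local weak derivative in L² (`exists_weak_partial_of_difference_quotient`).
Uniqueness of weak derivatives glues these over a countable exhaustion of Ω
(`exists_glued_weak_partial`). -/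

/-! ### Pointwise inequalities for power maps and for H. -/

/-- Bernoulli's inequality with exponent m + 1 at t/s - 1. Keeping the factor t on the left avoids
the power m - 1, so small m needs no separate case. -/
theorem rpow_sub_rpow_mul_le {m s t : ℝ} (hm : 0 ≤ m) (ht : 0 ≤ t) (hts : t ≤ s) :
    (s ^ m - t ^ m) * t ≤ m * s ^ m * (s - t) := by
  rcases (ht.trans hts).eq_or_lt with h0 | hs
  · have : t = 0 := le_antisymm (h0 ▸ hts) ht
    simp [this, ← h0]
  · have h1 : t ^ m * t = t ^ (m + 1) := by
      rw [Real.rpow_add' ht (by positivity), Real.rpow_one]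
    have h2 : s ^ m * s = s ^ (m + 1) := by
      rw [Real.rpow_add hs, Real.rpow_one]
    have hB := one_add_mul_self_le_rpow_one_add (s := t / s - 1)
      (by have : 0 ≤ t / s := by positivity
          linarith) (p := m + 1) (by linarith)
    rw [add_sub_cancel, Real.div_rpow ht hs.le, le_div_iff₀ (by positivity), ← h1, ← h2] at hB
    have h3 : (1 + (m + 1) * (t / s - 1)) * (s ^ m * s) = s ^ m * (s + (m + 1) * (t - s)) := by
      field_simp
    rw [h3] at hB
    nlinarith [hB]

theorem norm_rpow_smul_sub_le_of_le {V : Type*} [NormedAddCommGroup V] [NormedSpace ℝ V] {m : ℝ}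
    (hm : 0 ≤ m) {x y : V} (h : ‖y‖ ≤ ‖x‖) :
    ‖‖x‖ ^ m • x - ‖y‖ ^ m • y‖ ≤ (1 + m) * ‖x‖ ^ m * ‖x - y‖ := by
  have h1 : ‖x‖ ^ m • x - ‖y‖ ^ m • y = ‖x‖ ^ m • (x - y) + (‖x‖ ^ m - ‖y‖ ^ m) • y := by
    module
  have h2 : 0 ≤ ‖x‖ ^ m := by positivity
  have h3 : ‖y‖ ^ m ≤ ‖x‖ ^ m := Real.rpow_le_rpow (norm_nonneg _) h hm
  have h4 := rpow_sub_rpow_mul_le hm (norm_nonneg y) h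
  have h5 : ‖x‖ - ‖y‖ ≤ ‖x - y‖ := norm_sub_norm_le x y
  rw [h1]
  calc _ ≤ ‖x‖ ^ m * ‖x - y‖ + (‖x‖ ^ m - ‖y‖ ^ m) * ‖y‖ := by
        refine (norm_add_le _ _).trans (le_of_eq ?_)
        rw [norm_smul, norm_smul, Real.norm_of_nonneg h2, Real.norm_of_nonneg (sub_nonneg.2 h3)]
    _ ≤ ‖x‖ ^ m * ‖x - y‖ + m * ‖x‖ ^ m * ‖x - y‖ := by
        have := mul_le_mul_of_nonneg_left h5 (mul_nonneg hm h2)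
        linarith
    _ = _ := by ring

theorem norm_rpow_smul_sub_le {V : Type*} [NormedAddCommGroup V] [NormedSpace ℝ V] {m : ℝ}
    (hm : 0 ≤ m) (x y : V) :
    ‖‖x‖ ^ m • x - ‖y‖ ^ m • y‖ ≤ (1 + m) * (max ‖x‖ ‖y‖) ^ m * ‖x - y‖ := by
  rcases le_total ‖y‖ ‖x‖ with h | h
  · rw [max_eq_left h]
    exact norm_rpow_smul_sub_le_of_le hm h
  · rw [max_eq_right h, norm_sub_rev, norm_sub_rev x y]
    exact norm_rpow_smul_sub_le_of_le hm h

variable {n : ℕ}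

local notation "E" => EuclideanSpace ℝ (Fin n)

theorem norm_H {γ : ℝ} (hγ : 0 < γ) (ξ : E) : ‖H γ ξ‖ = (max (‖ξ‖ - 1) 0) ^ γ := by
  unfold H
  rw [norm_smul, Real.norm_of_nonneg (by positivity)]
  by_cases h : ξ = 0
  · simp [h, hγ.ne']
  · rw [norm_smul, norm_inv, norm_norm, inv_mul_cancel₀ (norm_ne_zero_iff.2 h), mul_one]

theorem norm_H_le {γ : ℝ} (hγ : 0 < γ) (ξ : E) : ‖H γ ξ‖ ≤ ‖ξ‖ ^ γ := by
  rw [norm_H hγ]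
  refine Real.rpow_le_rpow (by positivity) ?_ hγ.le
  exact max_le (by linarith) (norm_nonneg _)

/-- Reduces estimates for H to estimates for the power maps x ↦ |x|^k x, applied to H_1 or to
H_{p/2}. -/
theorem H_mul {γ k : ℝ} (hγ : 0 < γ) (hk : 0 ≤ k) (ξ : E) :
    H (γ * (k + 1)) ξ = ‖H γ ξ‖ ^ k • H γ ξ := by
  rw [norm_H hγ]
  unfold H
  rw [smul_smul (_ ^ k), ← Real.rpow_mul (by positivity), ← Real.rpow_add' (by positivity)
    (by positivity)]
  congr 2
  ring

theorem H_eq_zero_of_norm_le {γ : ℝ} (hγ : 0 < γ) {ξ : E} (h : ‖ξ‖ ≤ 1) : H γ ξ = 0 := by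
  rw [← norm_eq_zero, norm_H hγ, max_eq_right (by linarith), Real.zero_rpow hγ.ne']

theorem sub_H_one {ξ : E} (h : 1 ≤ ‖ξ‖) : ξ - H 1 ξ = ‖ξ‖⁻¹ • ξ := by
  unfold H
  rw [max_eq_left (by linarith), Real.rpow_one, smul_smul, sub_mul,
    mul_inv_cancel₀ (by positivity), sub_smul]
  simp

theorem norm_sub_H_one_le (ξ : E) : ‖ξ - H 1 ξ‖ ≤ 1 := by
  rcases le_total ‖ξ‖ 1 with h | h
  · simpa [H_eq_zero_of_norm_le one_pos h] using h
  · rw [sub_H_one h, norm_smul, norm_inv, norm_norm, inv_mul_cancel₀ (by positivity)]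

/-- The variational inequality of the projection ξ - H_1(ξ) onto the closed unit ball: H_γ(ξ) is
normal to the ball at the projected point, and is zero if ξ lies in the ball. -/
theorem inner_H_sub_nonneg {γ : ℝ} (hγ : 0 < γ) (ξ ζ : E) :
    0 ≤ inner ℝ (H γ ξ) ((ξ - H 1 ξ) - (ζ - H 1 ζ)) := by
  rcases le_total ‖ξ‖ 1 with h | h
  · simp [H_eq_zero_of_norm_le hγ h]
  · have h1 : ‖‖ξ‖⁻¹ • ξ‖ = 1 := by
      rw [norm_smul, norm_inv, norm_norm, inv_mul_cancel₀ (by positivity)]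
    have h2 := real_inner_le_norm (‖ξ‖⁻¹ • ξ) (ζ - H 1 ζ)
    rw [sub_H_one h]
    unfold H at h2 ⊢
    rw [inner_smul_left, inner_sub_right, real_inner_self_eq_norm_sq, h1]
    refine mul_nonneg (by simp; positivity) ?_
    have := norm_sub_H_one_le ζ
    unfold H at this
    rw [h1] at h2
    linarith

theorem inner_H_sub_H_ge {γ : ℝ} (hγ : 0 < γ) (ξ ζ : E) :
    inner ℝ (H γ ξ - H γ ζ) (H 1 ξ - H 1 ζ) ≤ inner ℝ (H γ ξ - H γ ζ) (ξ - ζ) := by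
  have h1 := inner_H_sub_nonneg hγ ξ ζ
  have h2 := inner_H_sub_nonneg hγ ζ ξ
  simp only [inner_sub_left, inner_sub_right] at *
  linarith

/-- With a = |x|^k and b = |y|^k, twice the inner product equals (a + b)|x - y|² + (a - b)(|x|² -
|y|²), and the last term is nonnegative by monotonicity of the power. -/
theorem inner_rpow_smul_sub_ge {V : Type*} [NormedAddCommGroup V] [InnerProductSpace ℝ V] {k : ℝ}
    (hk : 0 ≤ k) (x y : V) :
    (max ‖x‖ ‖y‖) ^ k * ‖x - y‖ ^ 2 ≤ 2 * inner ℝ (‖x‖ ^ k • x - ‖y‖ ^ k • y) (x - y) := by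
  have ha : 0 ≤ ‖x‖ ^ k := by positivity
  have hb : 0 ≤ ‖y‖ ^ k := by positivity
  have h1 : (max ‖x‖ ‖y‖) ^ k ≤ ‖x‖ ^ k + ‖y‖ ^ k := by
    rcases max_choice ‖x‖ ‖y‖ with h | h <;> rw [h] <;> linarith
  have h2 : 0 ≤ (‖x‖ ^ k - ‖y‖ ^ k) * (‖x‖ ^ 2 - ‖y‖ ^ 2) := by
    rcases le_total ‖x‖ ‖y‖ with h | h
    · exact mul_nonneg_of_nonpos_of_nonpos
        (sub_nonpos.2 (Real.rpow_le_rpow (norm_nonneg _) h hk))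
        (sub_nonpos.2 (by gcongr))
    · exact mul_nonneg (sub_nonneg.2 (Real.rpow_le_rpow (norm_nonneg _) h hk))
        (sub_nonneg.2 (by gcongr))
  refine (mul_le_mul_of_nonneg_right h1 (sq_nonneg _)).trans ?_
  rw [norm_sub_sq_real]
  simp only [inner_sub_left, inner_sub_right, inner_smul_left, real_inner_self_eq_norm_sq,
    real_inner_comm x y, RCLike.conj_to_real]
  nlinarith [h2]

theorem norm_H_sub_sq_le {p : ℝ} (hp : 2 ≤ p) (ξ ζ : E) :
    ‖H (p / 2) ξ - H (p / 2) ζ‖ ^ 2 ≤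
      p ^ 2 / 2 * inner ℝ (H (p - 1) ξ - H (p - 1) ζ) (ξ - ζ) := by
  have e1 : p / 2 = 1 * ((p / 2 - 1) + 1) := by ring
  have e2 : p - 1 = 1 * ((p - 2) + 1) := by ring
  have h1 := norm_rpow_smul_sub_le (m := p / 2 - 1) (by linarith) (H 1 ξ) (H 1 ζ)
  rw [← H_mul one_pos (by linarith), ← H_mul one_pos (by linarith), ← e1] at h1
  have h2 := inner_rpow_smul_sub_ge (k := p - 2) (by linarith) (H 1 ξ) (H 1 ζ)
  rw [← H_mul one_pos (by linarith), ← H_mul one_pos (by linarith), ← e2] at h2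
  have h3 := inner_H_sub_H_ge (γ := p - 1) (by linarith) ξ ζ
  have h4 : ((max ‖H 1 ξ‖ ‖H 1 ζ‖) ^ (p / 2 - 1)) ^ 2 = (max ‖H 1 ξ‖ ‖H 1 ζ‖) ^ (p - 2) := by
    rw [← Real.rpow_natCast, ← Real.rpow_mul (by positivity)]
    congr 1
    push_cast
    ring
  calc _ ≤ ((1 + (p / 2 - 1)) * (max ‖H 1 ξ‖ ‖H 1 ζ‖) ^ (p / 2 - 1) * ‖H 1 ξ - H 1 ζ‖) ^ 2 := by
        gcongr
    _ = p ^ 2 / 4 * ((max ‖H 1 ξ‖ ‖H 1 ζ‖) ^ (p - 2) * ‖H 1 ξ - H 1 ζ‖ ^ 2) := by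
        rw [mul_pow, mul_pow, h4]
        ring
    _ ≤ p ^ 2 / 4 * (2 * inner ℝ (H (p - 1) ξ - H (p - 1) ζ) (ξ - ζ)) :=
        mul_le_mul_of_nonneg_left (h2.trans (by linarith)) (by positivity)
    _ = _ := by ring

theorem norm_H_sub_le {p : ℝ} (hp : 2 ≤ p) (ξ ζ : E) :
    ‖H (p - 1) ξ - H (p - 1) ζ‖ ≤
      2 * (max ‖ξ‖ ‖ζ‖) ^ (p / 2 - 1) * ‖H (p / 2) ξ - H (p / 2) ζ‖ := by
  have hp0 : (0 : ℝ) < p / 2 := by linarith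
  have hk : 0 ≤ (p - 2) / p := div_nonneg (by linarith) (by linarith)
  have hk1 : (p - 2) / p ≤ 1 := by
    rw [div_le_one (by linarith)]
    linarith
  -- The flux is the power map of exponent (p - 2)/p applied to H_{p/2}.
  have e1 : p - 1 = p / 2 * ((p - 2) / p + 1) := by
    field_simp
    ring
  have h1 := norm_rpow_smul_sub_le hk (H (p / 2) ξ) (H (p / 2) ζ)
  rw [← H_mul hp0 hk, ← H_mul hp0 hk, ← e1] at h1
  refine h1.trans ?_
  gcongr
  · linarith
  · have h2 : max ‖H (p / 2) ξ‖ ‖H (p / 2) ζ‖ ≤ (max ‖ξ‖ ‖ζ‖) ^ (p / 2) := by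
      refine max_le ((norm_H_le hp0 _).trans ?_) ((norm_H_le hp0 _).trans ?_)
      · gcongr
        exact le_max_left _ _
      · gcongr
        exact le_max_right _ _
    calc _ ≤ ((max ‖ξ‖ ‖ζ‖) ^ (p / 2)) ^ ((p - 2) / p) := by gcongr
      _ = _ := by
        rw [← Real.rpow_mul (by positivity)]
        congr 1
        field_simp

/-- The pointwise form of the Caccioppoli estimate for difference quotients. -/
theorem sq_mul_norm_H_sub_sq_le {p : ℝ} (hp : 2 ≤ p) (ξ ζ w : E) (η d : ℝ) :
    η ^ 2 * ‖H (p / 2) ξ - H (p / 2) ζ‖ ^ 2 ≤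
      p ^ 2 * inner ℝ (H (p - 1) ξ - H (p - 1) ζ) (η ^ 2 • (ξ - ζ) + (2 * η * d) • w) +
        4 * p ^ 4 * (d ^ 2 * ‖w‖ ^ 2 * (max ‖ξ‖ ‖ζ‖) ^ (p - 2)) := by
  have h1 := norm_H_sub_sq_le hp ξ ζ
  have h2 := norm_H_sub_le hp ξ ζ
  have h3 : (max ‖ξ‖ ‖ζ‖) ^ (p - 2) = ((max ‖ξ‖ ‖ζ‖) ^ (p / 2 - 1)) ^ 2 := by
    rw [← Real.rpow_natCast, ← Real.rpow_mul (by positivity)]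
    congr 1
    push_cast
    ring
  rw [h3]
  set W := (max ‖ξ‖ ‖ζ‖) ^ (p / 2 - 1)
  have hW : 0 ≤ W := by positivity
  set D := ‖H (p / 2) ξ - H (p / 2) ζ‖
  have hD : 0 ≤ D := norm_nonneg _
  set X := H (p - 1) ξ - H (p - 1) ζ
  have h4 : |inner ℝ X w| ≤ 2 * W * D * ‖w‖ :=
    (abs_real_inner_le_norm X w).trans (by gcongr)
  rw [inner_add_right, inner_smul_right, inner_smul_right]
  set T := inner ℝ X (ξ - ζ)
  have h5 : -(p ^ 2 * (2 * η * d * inner ℝ X w)) ≤ p ^ 2 * (2 * |η| * |d| * (2 * W * D * ‖w‖)) := by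
    refine (neg_le_abs _).trans ?_
    simp only [abs_mul, abs_pow, abs_two, sq_abs]
    gcongr
  have h6 : η ^ 2 * D ^ 2 ≤ η ^ 2 * (p ^ 2 / 2 * T) := by gcongr
  -- Young's inequality. Doubling the monotonicity estimate leaves two copies of η²D² on the left;
  -- one absorbs the cross term, which is why p²/2 becomes p².
  have h7 : 2 * (|η| * D) * (2 * p ^ 2 * |d| * ‖w‖ * W) ≤
      (|η| * D) ^ 2 + (2 * p ^ 2 * |d| * ‖w‖ * W) ^ 2 := two_mul_le_add_sq _ _
  have h8 : (|η| * D) ^ 2 = η ^ 2 * D ^ 2 := by rw [mul_pow, sq_abs]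
  have h9 : (2 * p ^ 2 * |d| * ‖w‖ * W) ^ 2 = 4 * p ^ 4 * (d ^ 2 * ‖w‖ ^ 2 * W ^ 2) := by
    rw [mul_pow, mul_pow, mul_pow, mul_pow, sq_abs]
    ring
  rw [h8, h9] at h7
  nlinarith

/-! ### Averages, translations and mollification in L^q. -/

theorem eLpNorm_rpow_toReal {X V : Type*} [MeasurableSpace X] [NormedAddCommGroup V] {q : ENNReal}
    (hq0 : q ≠ 0) (hq' : q ≠ ⊤) (μ : Measure X) (g : X → V) :
    eLpNorm g q μ ^ q.toReal = ∫⁻ z, ‖g z‖ₑ ^ q.toReal ∂μ := by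
  rw [eLpNorm_eq_lintegral_rpow_enorm_toReal hq0 hq', ← ENNReal.rpow_mul,
    one_div_mul_cancel (ENNReal.toReal_pos hq0 hq').ne', ENNReal.rpow_one]

/-- Minkowski's integral inequality for averages against a probability measure. -/
theorem eLpNorm_integral_le_of_forall_ae {X Y V : Type*} [MeasurableSpace X] [MeasurableSpace Y]
    [NormedAddCommGroup V] [NormedSpace ℝ V] {μ : Measure X} [SFinite μ] {ν : Measure Y}
    [IsProbabilityMeasure ν] {q : ENNReal} (hq : 1 ≤ q) (hq' : q ≠ ⊤) {F : X → Y → V}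
    (hF : AEStronglyMeasurable (Function.uncurry F) (μ.prod ν)) {B : ENNReal}
    (hB : ∀ᵐ y ∂ν, eLpNorm (fun x => F x y) q μ ≤ B) :
    eLpNorm (fun x => ∫ y, F x y ∂ν) q μ ≤ B := by
  have hq0 : q ≠ 0 := (one_pos.trans_le hq).ne'
  have hr : 0 < q.toReal := ENNReal.toReal_pos hq0 hq'
  rw [← ENNReal.rpow_le_rpow_iff hr, eLpNorm_rpow_toReal hq0 hq']
  calc ∫⁻ x, ‖∫ y, F x y ∂ν‖ₑ ^ q.toReal ∂μ
      ≤ ∫⁻ x, ∫⁻ y, ‖F x y‖ₑ ^ q.toReal ∂ν ∂μ := by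
        refine lintegral_mono_ae ?_
        filter_upwards [hF.prodMk_left] with x hx
        rw [← eLpNorm_rpow_toReal hq0 hq']
        gcongr
        refine (enorm_integral_le_lintegral_enorm _).trans ?_
        rw [← eLpNorm_one_eq_lintegral_enorm]
        exact eLpNorm_le_eLpNorm_of_exponent_le hq hx
    _ = ∫⁻ y, ∫⁻ x, ‖F x y‖ₑ ^ q.toReal ∂μ ∂ν :=
        lintegral_lintegral_swap (hF.enorm.pow_const _)
    _ ≤ ∫⁻ _, B ^ q.toReal ∂ν := by
        refine lintegral_mono_ae ?_
        filter_upwards [hB] with y hy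
        rw [← eLpNorm_rpow_toReal hq0 hq']
        gcongr
    _ = B ^ q.toReal := by simp

theorem tendsto_eLpNorm_translate_sub {V : Type*} [NormedAddCommGroup V] {q : ENNReal}
    (hq : 1 ≤ q) (hq' : q ≠ ⊤) {f : E → V} (hf : MemLp f q volume) :
    Tendsto (fun t : E => eLpNorm (fun x => f (x - t) - f x) q volume) (𝓝 0) (𝓝 0) := by
  have : Fact (1 ≤ q) := ⟨hq⟩
  have hm : ∀ t : E, MeasurePreserving (fun x : E => x - t) volume volume :=
    fun t => measurePreserving_sub_right volume t
  let g : E → C(E, E) := fun t => ⟨fun x => x - t, by fun_prop⟩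
  have hg : Continuous g :=
    ContinuousMap.continuous_of_continuous_uncurry _
      (by change Continuous (fun p : E × E => p.2 - p.1); fun_prop)
  have h1 : Tendsto (fun t : E => Lp.compMeasurePreserving (g t) (hm t) (hf.toLp f)) (𝓝 0)
      (𝓝 (Lp.compMeasurePreserving (g 0) (hm 0) (hf.toLp f))) :=
    Filter.Tendsto.compMeasurePreservingLp tendsto_const_nhds (hg.tendsto 0) hm (hm 0) hq'
  have h2 := (tendsto_iff_edist_tendsto_0.1 h1)
  refine h2.congr fun t => ?_
  rw [Lp.toLp_compMeasurePreserving, Lp.toLp_compMeasurePreserving, Lp.edist_toLp_toLp]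
  refine eLpNorm_congr_ae (Eventually.of_forall fun x => ?_)
  simp [g]

/-- A mollification is an average of small translates, so Minkowski's inequality reduces it to
continuity of translation. The threshold works for every bump of small radius, so one kernel can
serve a function and its gradient at once. -/
theorem exists_eLpNorm_mollification_sub_le {V : Type*} [NormedAddCommGroup V] [NormedSpace ℝ V]
    [CompleteSpace V] {q : ENNReal} (hq : 1 ≤ q) (hq' : q ≠ ⊤) {f : E → V}
    (hf : MemLp f q volume) {ε : ENNReal} (hε : ε ≠ 0) :
    ∃ δ : ℝ, 0 < δ ∧ ∀ ρ : ContDiffBump (0 : E), ρ.rOut < δ →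
      eLpNorm (fun x => (∫ t, ρ.normed volume t • f (x - t)) - f x) q volume ≤ ε := by
  obtain ⟨δ, hδ, h⟩ := Metric.eventually_nhds_iff.1
    ((tendsto_eLpNorm_translate_sub hq hq' hf).eventually_le_const (pos_iff_ne_zero.2 hε))
  refine ⟨δ, hδ, fun ρ hρ => ?_⟩
  set r : E → NNReal := fun t => ⟨ρ.normed volume t, ρ.nonneg_normed t⟩ with hr
  have hrc : Continuous r := Continuous.subtype_mk ρ.continuous_normed _
  set ν : Measure E := volume.withDensity (fun t => (r t : ENNReal)) with hν
  have hprob : IsProbabilityMeasure ν := by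
    refine ⟨?_⟩
    rw [hν, withDensity_apply _ MeasurableSet.univ, Measure.restrict_univ,
      ← ENNReal.toReal_eq_one_iff, ← integral_toReal (by fun_prop) (by simp)]
    exact ρ.integral_normed
  have hfl : LocallyIntegrable f volume := hf.locallyIntegrable hq
  have e1 : ∀ x, (∫ t, ρ.normed volume t • f (x - t)) - f x = ∫ t, (f (x - t) - f x) ∂ν := by
    intro x
    have hc : Integrable (fun t => ρ.normed volume t • f (x - t)) volume :=
      (ρ.hasCompactSupport_normed (μ := volume)).convolutionExists_left
        (ContinuousLinearMap.lsmul ℝ ℝ) ρ.continuous_normed hfl x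
    rw [hν, integral_withDensity_eq_integral_smul hrc.measurable]
    simp only [smul_sub]
    rw [integral_sub]
    · congr 1
      change _ = ∫ t, ρ.normed volume t • f x
      rw [ρ.integral_normed_smul]
    · exact hc
    · exact ρ.integrable_normed.smul_const _
  simp_rw [e1]
  have hac : ν ≪ volume := withDensity_absolutelyContinuous _ _
  refine eLpNorm_integral_le_of_forall_ae hq hq' ?_ ?_
  · have h1 : AEStronglyMeasurable (fun z : E × E => f (z.1 - z.2) - f z.1) (volume.prod volume) :=
      (hf.1.comp_quasiMeasurePreserving (quasiMeasurePreserving_sub_of_right_invariant _ _)).sub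
        hf.1.comp_fst
    exact h1.mono_ac (Measure.AbsolutelyContinuous.rfl.prod hac)
  · have h0 : ∀ᵐ t ∂ν, r t ≠ 0 := by
      rw [hν, ae_withDensity_iff (by fun_prop)]
      exact Eventually.of_forall fun t ht => by simpa using ht
    filter_upwards [h0] with t ht
    refine h ?_
    have : t ∈ Function.support (ρ.normed volume) := by
      intro h
      exact ht (by ext; exact h)
    rw [ρ.support_normed_eq] at this
    exact lt_trans this hρ

/-! ### Gradients and test functions. -/

theorem gradient_apply (φ : E → ℝ) (x : E) (i : Fin n) :
    ∇ φ x i = fderiv ℝ φ x (EuclideanSpace.single i 1) := by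
  rw [← inner_gradient_left, EuclideanSpace.inner_single_right]
  simp

theorem gradient_mul {η φ : E → ℝ} {x : E} (hη : DifferentiableAt ℝ η x)
    (hφ : DifferentiableAt ℝ φ x) :
    ∇ (fun y => η y * φ y) x = η x • ∇ φ x + φ x • ∇ η x := by
  refine HasGradientAt.gradient ?_
  rw [hasGradientAt_iff_hasFDerivAt, map_add, map_smul, map_smul, toDual_gradient, toDual_gradient]
  exact hη.hasFDerivAt.mul hφ.hasFDerivAt

theorem gradient_sub {η φ : E → ℝ} {x : E} (hη : DifferentiableAt ℝ η x)
    (hφ : DifferentiableAt ℝ φ x) :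
    ∇ (fun y => η y - φ y) x = ∇ η x - ∇ φ x := by
  refine HasGradientAt.gradient ?_
  rw [hasGradientAt_iff_hasFDerivAt, map_sub, toDual_gradient, toDual_gradient]
  exact hη.hasFDerivAt.sub hφ.hasFDerivAt

theorem gradient_comp_add_right (φ : E → ℝ) (v x : E) :
    ∇ (fun y => φ (y + v)) x = ∇ φ (x + v) := by
  simp only [gradient, fderiv_comp_add_right]

theorem continuous_gradient {φ : E → ℝ} (hφ : ContDiff ℝ ∞ φ) : Continuous (∇ φ) := by
  unfold gradient
  exact (LinearIsometryEquiv.continuous _).comp (hφ.continuous_fderiv (by simp))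

theorem support_gradient_subset (φ : E → ℝ) : Function.support (∇ φ) ⊆ tsupport φ := by
  intro x hx
  refine support_fderiv_subset ℝ (f := φ) ?_
  intro h
  apply hx
  simp [gradient, h]

namespace IsTestFunction

variable {U U' : Set (EuclideanSpace ℝ (Fin n))} {φ ψ : EuclideanSpace ℝ (Fin n) → ℝ}

theorem mono (h : IsTestFunction U φ) (hU : U ⊆ U') : IsTestFunction U' φ :=
  ⟨h.1, h.2.1, h.2.2.trans hU⟩

theorem continuous (h : IsTestFunction U φ) : Continuous φ := h.1.continuous

theorem differentiable (h : IsTestFunction U φ) : Differentiable ℝ φ :=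
  h.1.differentiable (by simp)

theorem continuous_gradient (h : IsTestFunction U φ) : Continuous (∇ φ) :=
  WidelyDegenerate.continuous_gradient h.1

theorem hasCompactSupport_gradient (h : IsTestFunction U φ) : HasCompactSupport (∇ φ) :=
  h.2.1.mono' (support_gradient_subset φ)

theorem mul_left (h : IsTestFunction U φ) (hψ : ContDiff ℝ ∞ ψ) :
    IsTestFunction U (fun x => φ x * ψ x) :=
  ⟨h.1.mul hψ, h.2.1.mul_right, (tsupport_mul_subset_left).trans h.2.2⟩

theorem sub (h : IsTestFunction U φ) (hψ : IsTestFunction U ψ) :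
    IsTestFunction U (fun x => φ x - ψ x) :=
  ⟨h.1.sub hψ.1, h.2.1.sub hψ.2.1,
    (tsupport_sub φ ψ).trans (Set.union_subset h.2.2 hψ.2.2)⟩

theorem comp_add_right (h : IsTestFunction U φ) {v : E}
    (hU : ∀ x, x + v ∈ tsupport φ → x ∈ U') : IsTestFunction U' (fun x => φ (x + v)) := by
  refine ⟨h.1.comp (by fun_prop), h.2.1.comp_homeomorph (Homeomorph.addRight v), ?_⟩
  intro x hx
  exact hU x (tsupport_comp_subset_preimage φ (f := fun x => x + v) (by fun_prop) hx)

theorem memLp (h : IsTestFunction U φ) (q : ENNReal) : MemLp φ q volume :=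
  h.continuous.memLp_of_hasCompactSupport h.2.1

theorem memLp_gradient (h : IsTestFunction U φ) (q : ENNReal) : MemLp (∇ φ) q volume :=
  h.continuous_gradient.memLp_of_hasCompactSupport h.hasCompactSupport_gradient

theorem exists_bound (h : IsTestFunction U φ) : ∃ C : ℝ, 0 ≤ C ∧ ∀ x, ‖φ x‖ ≤ C ∧ ‖∇ φ x‖ ≤ C := by
  obtain ⟨C, hC⟩ := h.continuous.bounded_above_of_compact_support h.2.1
  obtain ⟨C', hC'⟩ := h.continuous_gradient.bounded_above_of_compact_support
    h.hasCompactSupport_gradient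
  exact ⟨max C C', (norm_nonneg _).trans ((hC 0).trans (le_max_left _ _)),
    fun x => ⟨(hC x).trans (le_max_left _ _), (hC' x).trans (le_max_right _ _)⟩⟩

theorem eq_zero_of_notMem (h : IsTestFunction U φ) {x : E} (hx : x ∉ U) : φ x = 0 :=
  image_eq_zero_of_notMem_tsupport fun h' => hx (h.2.2 h')

theorem gradient_eq_zero_of_notMem (h : IsTestFunction U φ) {x : E} (hx : x ∉ U) : ∇ φ x = 0 := by
  by_contra h'
  exact hx (h.2.2 (support_gradient_subset φ h'))

/-- The difference quotients of a smooth function are controlled by its gradient. -/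
theorem eLpNorm_translate_sub_le (h : IsTestFunction U φ) {q : ENNReal} (hq : 1 ≤ q) (hq' : q ≠ ⊤)
    (v : E) : eLpNorm (fun x => φ (x + v) - φ x) q volume ≤
      ENNReal.ofReal ‖v‖ * eLpNorm (∇ φ) q volume := by
  -- The increment is an average over the probability space (0, 1], the setting of Minkowski's
  -- inequality for averages.
  have e1 : ∀ x, φ (x + v) - φ x =
      ∫ t, inner ℝ (∇ φ (x + t • v)) v ∂(volume.restrict (Set.Ioc (0 : ℝ) 1)) := by
    intro x
    rw [← intervalIntegral.integral_of_le zero_le_one,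
      intervalIntegral.integral_eq_sub_of_hasDerivAt (f := fun t : ℝ => φ (x + t • v))]
    · simp
    · intro t _
      rw [inner_gradient_left]
      have h1 : HasDerivAt (fun t : ℝ => x + t • v) v t := by
        simpa using ((hasDerivAt_id t).smul_const v).const_add x
      exact (h.differentiable _).hasFDerivAt.comp_hasDerivAt t h1
    · refine Continuous.intervalIntegrable ?_ _ _
      exact (h.continuous_gradient.comp (by fun_prop)).inner continuous_const
  simp_rw [e1]
  have : IsProbabilityMeasure (volume.restrict (Set.Ioc (0 : ℝ) 1)) := ⟨by simp⟩
  refine eLpNorm_integral_le_of_forall_ae hq hq' ?_ (Eventually.of_forall fun t => ?_)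
  · refine Continuous.aestronglyMeasurable ?_
    exact (h.continuous_gradient.comp (by fun_prop)).inner continuous_const
  · have h2 : eLpNorm (fun x => ∇ φ (x + t • v)) q volume = eLpNorm (∇ φ) q volume :=
      eLpNorm_comp_measurePreserving h.continuous_gradient.aestronglyMeasurable
        (measurePreserving_add_right volume (t • v))
    rw [← h2]
    refine eLpNorm_le_mul_eLpNorm_of_ae_le_mul (Eventually.of_forall fun x => ?_) q
    rw [mul_comm]
    exact norm_inner_le_norm _ _

end IsTestFunction

/-! ### Calculus of Sobolev functions approximable by test functions. -/

namespace HasSobolevGradientZero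

variable {U U' : Set (EuclideanSpace ℝ (Fin n))} {q : ENNReal}
  {g g' : EuclideanSpace ℝ (Fin n) → ℝ}
  {G G' : EuclideanSpace ℝ (Fin n) → EuclideanSpace ℝ (Fin n)}

theorem comp_add_right (h : HasSobolevGradientZero Set.univ q g G) (v : E) :
    HasSobolevGradientZero Set.univ q (fun x => g (x + v)) (fun x => G (x + v)) := by
  have hm : MeasurePreserving (fun x : E => x + v) volume volume := measurePreserving_add_right _ v
  obtain ⟨ψ, h1, h2, h3⟩ := h.exists_approx
  refine ⟨h.memLp.comp_measurePreserving hm, h.memLp_gradient.comp_measurePreserving hm,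
    fun k x => ψ k (x + v), fun k => (h1 k).comp_add_right (fun _ _ => Set.mem_univ _), ?_, ?_⟩
  · refine h2.congr fun k => ?_
    exact (eLpNorm_comp_measurePreserving
      (((h1 k).memLp q).1.sub h.memLp.1) hm).symm
  · refine h3.congr fun k => ?_
    simp_rw [gradient_comp_add_right]
    exact (eLpNorm_comp_measurePreserving
      (((h1 k).memLp_gradient q).1.sub h.memLp_gradient.1) hm).symm

theorem sub (hq : 1 ≤ q) (h : HasSobolevGradientZero U q g G)
    (h' : HasSobolevGradientZero U q g' G') :
    HasSobolevGradientZero U q (fun x => g x - g' x) (fun x => G x - G' x) := by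
  obtain ⟨ψ, h1, h2, h3⟩ := h.exists_approx
  obtain ⟨ψ', h1', h2', h3'⟩ := h'.exists_approx
  refine ⟨h.memLp.sub h'.memLp, h.memLp_gradient.sub h'.memLp_gradient,
    fun k x => ψ k x - ψ' k x, fun k => (h1 k).sub (h1' k), ?_, ?_⟩
  · have h4 := h2.add h2'
    rw [add_zero] at h4
    refine tendsto_of_tendsto_of_tendsto_of_le_of_le tendsto_const_nhds h4 (fun _ => zero_le)
      fun k => ?_
    refine le_trans (le_of_eq ?_) (eLpNorm_sub_le (((h1 k).memLp q).1.sub h.memLp.1)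
      (((h1' k).memLp q).1.sub h'.memLp.1) hq)
    congr 1
    ext x
    simp only [Pi.sub_apply]
    ring
  · have h4 := h3.add h3'
    rw [add_zero] at h4
    refine tendsto_of_tendsto_of_tendsto_of_le_of_le tendsto_const_nhds h4 (fun _ => zero_le)
      fun k => ?_
    refine le_trans (le_of_eq ?_) (eLpNorm_sub_le
      (((h1 k).memLp_gradient q).1.sub h.memLp_gradient.1)
      (((h1' k).memLp_gradient q).1.sub h'.memLp_gradient.1) hq)
    congr 1
    ext1 x
    simp only [Pi.sub_apply]
    rw [gradient_sub ((h1 k).differentiable _) ((h1' k).differentiable _)]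
    abel

theorem mul_testFunction (hq : 1 ≤ q) (h : HasSobolevGradientZero U q g G) {η : E → ℝ}
    (hη : IsTestFunction U' η) :
    HasSobolevGradientZero U' q (fun x => η x * g x) (fun x => η x • G x + g x • ∇ η x) := by
  obtain ⟨ψ, h1, h2, h3⟩ := h.exists_approx
  obtain ⟨C, hC0, hC⟩ := hη.exists_bound
  have hm1 : MemLp (fun x => η x • G x) q volume :=
    h.memLp_gradient.of_le_mul (c := C) (hη.continuous.aestronglyMeasurable.smul h.memLp_gradient.1)
      (Eventually.of_forall fun x => by rw [norm_smul]; gcongr; exact (hC x).1)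
  have hm2 : MemLp (fun x => g x • ∇ η x) q volume :=
    h.memLp.of_le_mul (c := C) (h.memLp.1.smul hη.continuous_gradient.aestronglyMeasurable)
      (Eventually.of_forall fun x => by rw [norm_smul, mul_comm]; gcongr; exact (hC x).2)
  have hlim : ∀ {a : ℕ → ENNReal}, Tendsto a atTop (𝓝 0) →
      Tendsto (fun k => ENNReal.ofReal C * a k) atTop (𝓝 0) := by
    intro a ha
    simpa using ENNReal.Tendsto.const_mul ha (Or.inr ENNReal.ofReal_ne_top)
  refine ⟨h.memLp.of_le_mul (c := C) (hη.continuous.aestronglyMeasurable.mul h.memLp.1)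
      (Eventually.of_forall fun x => by rw [norm_mul]; gcongr; exact (hC x).1),
    hm1.add hm2, fun k x => η x * ψ k x, fun k => hη.mul_left (h1 k).1, ?_, ?_⟩
  · refine tendsto_of_tendsto_of_tendsto_of_le_of_le tendsto_const_nhds (hlim h2)
      (fun _ => zero_le) fun k => ?_
    refine eLpNorm_le_mul_eLpNorm_of_ae_le_mul (Eventually.of_forall fun x => ?_) q
    rw [← mul_sub, norm_mul]
    gcongr
    exact (hC x).1
  · have h4 := (hlim h3).add (hlim h2)
    rw [add_zero] at h4
    refine tendsto_of_tendsto_of_tendsto_of_le_of_le tendsto_const_nhds h4 (fun _ => zero_le)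
      fun k => ?_
    have e : (fun x => ∇ (fun y => η y * ψ k y) x - (η x • G x + g x • ∇ η x)) =
        (fun x => η x • (∇ (ψ k) x - G x)) + fun x => (ψ k x - g x) • ∇ η x := by
      ext1 x
      rw [gradient_mul (hη.differentiable _) ((h1 k).differentiable _)]
      simp only [Pi.add_apply]
      module
    rw [e]
    refine (eLpNorm_add_le (hη.continuous.aestronglyMeasurable.smul
      (((h1 k).memLp_gradient q).1.sub h.memLp_gradient.1))
      ((((h1 k).memLp q).1.sub h.memLp.1).smul hη.continuous_gradient.aestronglyMeasurable) hq).trans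
      (add_le_add ?_ ?_)
    · refine eLpNorm_le_mul_eLpNorm_of_ae_le_mul (Eventually.of_forall fun x => ?_) q
      change ‖η x • (∇ (ψ k) x - G x)‖ ≤ _
      rw [norm_smul]
      gcongr
      exact (hC x).1
    · refine eLpNorm_le_mul_eLpNorm_of_ae_le_mul (Eventually.of_forall fun x => ?_) q
      change ‖(ψ k x - g x) • ∇ η x‖ ≤ _
      rw [norm_smul, mul_comm]
      gcongr
      exact (hC x).2

/-- The difference quotients of a Sobolev function are controlled by its weak gradient. -/
theorem eLpNorm_translate_sub_le (hq : 1 ≤ q) (hq' : q ≠ ⊤) (h : HasSobolevGradientZero U q g G)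
    (v : E) : eLpNorm (fun x => g (x + v) - g x) q volume ≤
      ENNReal.ofReal ‖v‖ * eLpNorm G q volume := by
  obtain ⟨ψ, h1, h2, h3⟩ := h.exists_approx
  have hm : MeasurePreserving (fun x : E => x + v) volume volume := measurePreserving_add_right _ v
  have hlim : Tendsto (fun k => eLpNorm (fun x => ψ k x - g x) q volume +
      ENNReal.ofReal ‖v‖ * (eLpNorm (fun x => ∇ (ψ k) x - G x) q volume + eLpNorm G q volume) +
      eLpNorm (fun x => ψ k x - g x) q volume) atTop
      (𝓝 (0 + ENNReal.ofReal ‖v‖ * (0 + eLpNorm G q volume) + 0)) :=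
    (h2.add (ENNReal.Tendsto.const_mul (h3.add tendsto_const_nhds)
      (Or.inr ENNReal.ofReal_ne_top))).add h2
  rw [zero_add, zero_add, add_zero] at hlim
  refine ge_of_tendsto' hlim fun k => ?_
  have ma := ((h1 k).memLp q).1.sub h.memLp.1
  have mb := ma.comp_measurePreserving hm
  have mc := ((h1 k).memLp q).1.comp_measurePreserving hm
  have e : (fun x => g (x + v) - g x) = (fun x => ψ k (x + v) - ψ k x) -
      (fun x => ψ k (x + v) - g (x + v)) + (fun x => ψ k x - g x) := by
    ext x
    simp only [Pi.add_apply, Pi.sub_apply]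
    ring
  have e2 : ∇ (ψ k) = (fun x => ∇ (ψ k) x - G x) + G := by
    ext1 x
    simp
  rw [e]
  refine (eLpNorm_add_le ((mc.sub ((h1 k).memLp q).1).sub mb) ma hq).trans
    (add_le_add ?_ le_rfl)
  refine (eLpNorm_sub_le (mc.sub ((h1 k).memLp q).1) mb hq).trans ?_
  rw [add_comm]
  gcongr
  · exact (eLpNorm_comp_measurePreserving ma hm).le
  · refine ((h1 k).eLpNorm_translate_sub_le hq hq' v).trans ?_
    gcongr
    nth_rewrite 1 [e2]
    exact eLpNorm_add_le (((h1 k).memLp_gradient q).1.sub h.memLp_gradient.1) h.memLp_gradient.1 hq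

end HasSobolevGradientZero

/-! ### Cutting off and smoothing local Sobolev functions. -/

theorem exists_compactlyIncluded_superset {Ω K : Set (EuclideanSpace ℝ (Fin n))} (hΩ : IsOpen Ω)
    (hK : IsCompact K) (hKΩ : K ⊆ Ω) :
    ∃ U, CompactlyIncluded U Ω ∧ K ⊆ U := by
  obtain ⟨L, hL, h1, h2⟩ := exists_compact_between hK hΩ hKΩ
  have h3 : closure (interior L) ⊆ L := closure_minimal interior_subset hL.isClosed
  exact ⟨interior L, ⟨isOpen_interior, hL.of_isClosed_subset isClosed_closure h3, h3.trans h2⟩, h1⟩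

/-- Since w need not be measurable outside Ω, it is replaced by its indicator on a neighbourhood of
K. Writing h as B(w(x), x) with B vanishing off K shows that this leaves h unchanged, and so gives
its global measurability. -/
theorem memLp_of_memLpLoc {V W : Type*} [NormedAddCommGroup V] [NormedAddCommGroup W]
    {Ω K : Set (EuclideanSpace ℝ (Fin n))} {q : ENNReal} {w : E → W} (hΩ : IsOpen Ω)
    (hw : MemLpLoc Ω q w) (hK : IsCompact K) (hKΩ : K ⊆ Ω) {h : E → V} {B : W → E → V}
    (hB : ∀ w' : E → W, AEStronglyMeasurable w' volume →
      AEStronglyMeasurable (fun x => B (w' x) x) volume)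
    (hBK : ∀ c, ∀ x ∉ K, B c x = 0) (hh : ∀ x, h x = B (w x) x) {C : ℝ}
    (hC : ∀ x, ‖h x‖ ≤ C * ‖w x‖) : MemLp h q volume := by
  obtain ⟨U, hU, hKU⟩ := exists_compactlyIncluded_superset hΩ hK hKΩ
  have h1 : MemLp (U.indicator w) q volume :=
    (memLp_indicator_iff_restrict hU.1.measurableSet).2 (hw U hU)
  have h2 : ∀ x, h x = B (U.indicator w x) x := by
    intro x
    by_cases hx : x ∈ U
    · rw [Set.indicator_of_mem hx, hh]
    · rw [hh, hBK _ x (fun h => hx (hKU h)), hBK _ x (fun h => hx (hKU h))]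
  refine h1.of_le_mul (c := C) ?_ (Eventually.of_forall fun x => ?_)
  · rw [funext h2]
    exact hB _ h1.1
  · by_cases hx : x ∈ U
    · rw [Set.indicator_of_mem hx]
      exact hC x
    · rw [hh, hBK _ x (fun h => hx (hKU h)), Set.indicator_of_notMem hx]
      simp

theorem gradient_mollification {g : E → ℝ} {G : E → E} (h : IsWeakGradient Set.univ g G)
    (ρ : ContDiffBump (0 : E)) (x : E) :
    ∇ (fun x => ∫ t, ρ.normed volume t • g (x - t)) x =
      ∫ t, ρ.normed volume t • G (x - t) := by
  have hg : LocallyIntegrable g volume := locallyIntegrableOn_univ.1 h.locallyIntegrable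
  have hG : LocallyIntegrable G volume := locallyIntegrableOn_univ.1 h.locallyIntegrable_gradient
  have hρ : ContDiff ℝ ∞ (ρ.normed volume) := ρ.contDiff_normed
  have hρ1 : ContDiff ℝ 1 (ρ.normed volume) := ρ.contDiff_normed
  have hρs := ρ.hasCompactSupport_normed (μ := volume)
  have hd := hρs.hasFDerivAt_convolution_left (ContinuousLinearMap.lsmul ℝ ℝ) hρ1 hg x
  have hex : Integrable (fun t => ((ContinuousLinearMap.lsmul ℝ ℝ).precompL E)
      (fderiv ℝ (ρ.normed volume) t) (g (x - t))) volume :=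
    (hρs.fderiv ℝ).convolutionExists_left _ (hρ1.continuous_fderiv (by simp)) hg x
  have hGex : Integrable (fun t => ρ.normed volume t • G (x - t)) volume :=
    hρs.convolutionExists_left (ContinuousLinearMap.lsmul ℝ ℝ) hρ.continuous hG x
  ext i
  rw [gradient_apply]
  have e1 : fderiv ℝ (fun x => ∫ t, ρ.normed volume t • g (x - t)) x (EuclideanSpace.single i 1) =
      ∫ t, fderiv ℝ (ρ.normed volume) t (EuclideanSpace.single i 1) * g (x - t) := by
    refine (congrArg (fun A => A (EuclideanSpace.single i 1)) hd.fderiv).trans ?_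
    simp only [convolution]
    rw [ContinuousLinearMap.integral_apply hex]
    rfl
  have e2 : (∫ t, ρ.normed volume t • G (x - t)) i = ∫ t, ρ.normed volume t * G (x - t) i :=
    ((EuclideanSpace.proj i : E →L[ℝ] ℝ).integral_comp_comm hGex).symm
  rw [e1, e2, ← integral_sub_left_eq_self _ volume x,
    ← integral_sub_left_eq_self (fun t => ρ.normed volume t * G (x - t) i) volume x]
  simp only [sub_sub_cancel]
  -- The reflected kernel is an admissible test function; its reflection sign cancels the minus sign
  -- in the definition of the weak gradient.
  have hφ : IsTestFunction Set.univ (fun s => ρ.normed volume (x - s)) :=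
    ⟨hρ.comp (by fun_prop), hρs.comp_homeomorph (Homeomorph.subLeft x), Set.subset_univ _⟩
  have h1 := h.integral_eq _ hφ i
  rw [setIntegral_univ, setIntegral_univ] at h1
  have e3 : ∀ s, ∇ (fun s => ρ.normed volume (x - s)) s i =
      - fderiv ℝ (ρ.normed volume) (x - s) (EuclideanSpace.single i 1) := by
    intro s
    rw [gradient_apply]
    have h2 : HasFDerivAt (fun s => ρ.normed volume (x - s))
        ((fderiv ℝ (ρ.normed volume) (x - s)).comp (-ContinuousLinearMap.id ℝ E)) s :=
      HasFDerivAt.comp s (hρ.differentiable (by simp) _).hasFDerivAt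
        ((hasFDerivAt_id s).const_sub x)
    rw [h2.fderiv]
    simp
  simp only [e3, mul_neg, integral_neg, neg_inj] at h1
  simp only [mul_comm (ρ.normed volume _), ← h1]
  simp only [mul_comm]

/-- Density of test functions in the compactly supported Sobolev functions. -/
theorem HasSobolevGradientZero.of_isWeakGradient {g : E → ℝ} {G : E → E} {q : ENNReal}
    (hq : 1 ≤ q) (hq' : q ≠ ⊤) (h : IsWeakGradient Set.univ g G) (hg : MemLp g q volume)
    (hG : MemLp G q volume) (hs : HasCompactSupport g) :
    HasSobolevGradientZero Set.univ q g G := by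
  have key : ∀ k : ℕ, ∃ ψ : E → ℝ, IsTestFunction Set.univ ψ ∧
      eLpNorm (fun x => ψ x - g x) q volume ≤ ((k : ENNReal) + 1)⁻¹ ∧
      eLpNorm (fun x => ∇ ψ x - G x) q volume ≤ ((k : ENNReal) + 1)⁻¹ := by
    intro k
    have hε : ((k : ENNReal) + 1)⁻¹ ≠ 0 := by simp
    obtain ⟨δ, hδ, h1⟩ := exists_eLpNorm_mollification_sub_le hq hq' hg hε
    obtain ⟨δ', hδ', h2⟩ := exists_eLpNorm_mollification_sub_le hq hq' hG hε
    let ρ : ContDiffBump (0 : E) := ⟨min δ δ' / 4, min δ δ' / 2, by positivity, by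
      have : 0 < min δ δ' := by positivity
      linarith⟩
    have hρ : ρ.rOut < min δ δ' := half_lt_self (by positivity)
    have hρs := ρ.hasCompactSupport_normed (μ := volume)
    refine ⟨fun x => ∫ t, ρ.normed volume t • g (x - t), ⟨?_, ?_, Set.subset_univ _⟩,
      h1 ρ (hρ.trans_le (min_le_left _ _)), ?_⟩
    · exact hρs.contDiff_convolution_left (ContinuousLinearMap.lsmul ℝ ℝ) ρ.contDiff_normed
        (hg.locallyIntegrable hq)
    · exact hρs.convolution (ContinuousLinearMap.lsmul ℝ ℝ) hs
    · simp_rw [gradient_mollification h ρ]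
      exact h2 ρ (hρ.trans_le (min_le_right _ _))
  choose ψ h1 h2 h3 using key
  have hlim : Tendsto (fun k : ℕ => ((k : ENNReal) + 1)⁻¹) atTop (𝓝 0) := by
    have := (tendsto_add_atTop_iff_nat 1).2 ENNReal.tendsto_inv_nat_nhds_zero
    simpa using this
  exact ⟨hg, hG, ψ, h1,
    tendsto_of_tendsto_of_tendsto_of_le_of_le tendsto_const_nhds hlim (fun _ => zero_le) h2,
    tendsto_of_tendsto_of_tendsto_of_le_of_le tendsto_const_nhds hlim (fun _ => zero_le) h3⟩

/-- Cutting off a local Sobolev function. -/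
theorem HasSobolevGradientLoc.mul_testFunction {Ω : Set (EuclideanSpace ℝ (Fin n))}
    (hΩ : IsOpen Ω) {q : ENNReal} (hq : 1 ≤ q) (hq' : q ≠ ⊤) {u : E → ℝ} {Du : E → E}
    (h : HasSobolevGradientLoc Ω q u Du) {ζ : E → ℝ} (hζ : IsTestFunction Ω ζ) :
    HasSobolevGradientZero Set.univ q (fun x => ζ x * u x)
      (fun x => ζ x • Du x + u x • ∇ ζ x) := by
  obtain ⟨C, hC0, hC⟩ := hζ.exists_bound
  have hz : ∀ x ∉ tsupport ζ, ζ x = 0 := fun x hx => image_eq_zero_of_notMem_tsupport hx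
  have hz' : ∀ x ∉ tsupport ζ, ∇ ζ x = 0 := fun x hx => by
    by_contra h'
    exact hx (support_gradient_subset ζ h')
  have m1 : MemLp (fun x => ζ x * u x) q volume :=
    memLp_of_memLpLoc hΩ h.memLpLoc hζ.2.1 hζ.2.2 (B := fun c x => ζ x * c)
      (fun w hw => hζ.continuous.aestronglyMeasurable.mul hw)
      (fun c x hx => by simp [hz x hx]) (fun _ => rfl) (C := C)
      (fun x => by rw [norm_mul]; gcongr; exact (hC x).1)
  have m2 : MemLp (fun x => ζ x • Du x) q volume :=
    memLp_of_memLpLoc hΩ h.memLpLoc_gradient hζ.2.1 hζ.2.2 (B := fun c x => ζ x • c)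
      (fun w hw => hζ.continuous.aestronglyMeasurable.smul hw)
      (fun c x hx => by simp [hz x hx]) (fun _ => rfl) (C := C)
      (fun x => by rw [norm_smul]; gcongr; exact (hC x).1)
  have m3 : MemLp (fun x => u x • ∇ ζ x) q volume :=
    memLp_of_memLpLoc hΩ h.memLpLoc hζ.2.1 hζ.2.2 (B := fun c x => c • ∇ ζ x)
      (fun w hw => hw.smul hζ.continuous_gradient.aestronglyMeasurable)
      (fun c x hx => by simp [hz' x hx]) (fun _ => rfl) (C := C)
      (fun x => by rw [norm_smul, mul_comm]; gcongr; exact (hC x).2)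
  refine .of_isWeakGradient hq hq' ⟨?_, ?_, ?_⟩ m1 (m2.add m3) hζ.2.1.mul_right
  · exact (m1.locallyIntegrable hq).locallyIntegrableOn _
  · exact ((m2.add m3).locallyIntegrable hq).locallyIntegrableOn _
  · intro φ hφ i
    have hφ' : Continuous φ := hφ.continuous
    have hdφ : Continuous (fun x => ∇ φ x i) :=
      (EuclideanSpace.proj i : E →L[ℝ] ℝ).continuous.comp hφ.continuous_gradient
    have hdφs : HasCompactSupport (fun x => ∇ φ x i) :=
      hφ.hasCompactSupport_gradient.comp_left (g := fun y : E => y i) (by simp)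
    have l1 := m1.locallyIntegrable hq
    have l2 : LocallyIntegrable (fun x => (ζ x • Du x) i) volume :=
      MemLp.locallyIntegrable (m2.continuousLinearMap_comp (EuclideanSpace.proj i : E →L[ℝ] ℝ)) hq
    have l3 : LocallyIntegrable (fun x => (u x • ∇ ζ x) i) volume :=
      MemLp.locallyIntegrable (m3.continuousLinearMap_comp (EuclideanSpace.proj i : E →L[ℝ] ℝ)) hq
    have i1 : Integrable (fun x => ζ x * u x * ∇ φ x i) volume :=
      l1.integrable_smul_right_of_hasCompactSupport hdφ hdφs
    have i2 : Integrable (fun x => (ζ x • Du x) i * φ x) volume :=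
      l2.integrable_smul_right_of_hasCompactSupport hφ' hφ.2.1
    have i3 : Integrable (fun x => (u x • ∇ ζ x) i * φ x) volume :=
      l3.integrable_smul_right_of_hasCompactSupport hφ' hφ.2.1
    -- Testing u with ζφ; the product rule turns the term u φ ∇ζ into the extra part of the new
    -- gradient.
    have h1 := h.isWeakGradient.integral_eq _ (hζ.mul_left hφ.1) i
    rw [setIntegral_eq_integral_of_forall_compl_eq_zero,
      setIntegral_eq_integral_of_forall_compl_eq_zero] at h1
    · rw [setIntegral_univ, setIntegral_univ]
      have e1 : ∀ x, u x * ∇ (fun x => ζ x * φ x) x i =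
          ζ x * u x * ∇ φ x i + (u x • ∇ ζ x) i * φ x := by
        intro x
        rw [gradient_mul (hζ.differentiable _) (hφ.differentiable _)]
        simp only [PiLp.add_apply, PiLp.smul_apply, smul_eq_mul]
        ring
      have e2 : ∀ x, Du x i * (ζ x * φ x) = (ζ x • Du x) i * φ x := by
        intro x
        simp only [PiLp.smul_apply, smul_eq_mul]
        ring
      have e3 : ∀ x, (ζ x • Du x + u x • ∇ ζ x) i * φ x =
          (ζ x • Du x) i * φ x + (u x • ∇ ζ x) i * φ x := by
        intro x
        rw [PiLp.add_apply, add_mul]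
      simp_rw [e3]
      simp_rw [e1, e2] at h1
      rw [integral_add i1 i3] at h1
      rw [integral_add i2 i3]
      linarith
    · intro x hx
      simp [hζ.eq_zero_of_notMem hx]
    · intro x hx
      rw [(hζ.mul_left hφ.1).gradient_eq_zero_of_notMem hx]
      simp

/-! ### Young-type inequalities and integrability. -/

/-- A crude form of Young's inequality: both factors are bounded by powers of max a b. Sharp
constants are not needed. -/
theorem rpow_mul_rpow_le_add {a b r s : ℝ} (ha : 0 ≤ a) (hb : 0 ≤ b) (hr : 0 ≤ r) (hs : 0 ≤ s)
    (hrs : 0 < r + s) : a ^ r * b ^ s ≤ a ^ (r + s) + b ^ (r + s) := by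
  have h1 : a ^ r * b ^ s ≤ (max a b) ^ (r + s) := by
    rw [Real.rpow_add' (by positivity) hrs.ne']
    gcongr
    · exact le_max_left _ _
    · exact le_max_right _ _
  have h2 : 0 ≤ a ^ (r + s) := by positivity
  have h3 : 0 ≤ b ^ (r + s) := by positivity
  refine h1.trans ?_
  rcases max_choice a b with h | h <;> rw [h] <;> linarith

theorem max_rpow_le_add {a b p : ℝ} (ha : 0 ≤ a) (hb : 0 ≤ b) :
    (max a b) ^ p ≤ a ^ p + b ^ p := by
  have h2 : 0 ≤ a ^ p := by positivity
  have h3 : 0 ≤ b ^ p := by positivity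
  rcases max_choice a b with h | h <;> rw [h] <;> linarith

theorem sq_le_one_add_rpow {a p : ℝ} (ha : 0 ≤ a) (hp : 2 ≤ p) : a ^ 2 ≤ 1 + a ^ p := by
  have h := rpow_mul_rpow_le_add (r := 2) (s := p - 2) ha zero_le_one (by norm_num) (by linarith)
    (by linarith)
  simp only [Real.one_rpow, mul_one, add_sub_cancel, Real.rpow_two] at h
  linarith

theorem le_one_add_rpow {a p : ℝ} (ha : 0 ≤ a) (hp : 2 ≤ p) : a ≤ 1 + a ^ p := by
  have h := rpow_mul_rpow_le_add (r := 1) (s := p - 1) ha zero_le_one (by norm_num) (by linarith)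
    (by linarith)
  simp only [Real.one_rpow, mul_one, add_sub_cancel, Real.rpow_one] at h
  linarith

theorem sq_mul_rpow_le {a b p : ℝ} (ha : 0 ≤ a) (hb : 0 ≤ b) (hp : 2 ≤ p) :
    a ^ 2 * b ^ (p - 2) ≤ a ^ p + b ^ p := by
  have h := rpow_mul_rpow_le_add (r := 2) (s := p - 2) ha hb (by norm_num) (by linarith)
    (by linarith)
  simpa using h

theorem measurable_H (γ : ℝ) : Measurable (H γ : E → E) := by
  unfold H
  fun_prop

theorem integrable_norm_rpow {V : Type*} [NormedAddCommGroup V] {p : ℝ} (hp : 2 ≤ p) {A : E → V}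
    (hA : MemLp A (ENNReal.ofReal p) volume) : Integrable (fun x => ‖A x‖ ^ p) volume := by
  have h := hA.integrable_norm_rpow (by simp; linarith) ENNReal.ofReal_ne_top
  rwa [ENNReal.toReal_ofReal (by linarith)] at h

theorem integral_norm_rpow_le {V W : Type*} [NormedAddCommGroup V] [NormedAddCommGroup W]
    {p : ℝ} (hp : 2 ≤ p) {A : E → V} {B : E → W} (hA : MemLp A (ENNReal.ofReal p) volume)
    (hB : MemLp B (ENNReal.ofReal p) volume) {c : ℝ} (hc : 0 ≤ c)
    (h : eLpNorm A (ENNReal.ofReal p) volume ≤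
      ENNReal.ofReal c * eLpNorm B (ENNReal.ofReal p) volume) :
    ∫ x, ‖A x‖ ^ p ≤ c ^ p * ∫ x, ‖B x‖ ^ p := by
  have hp0 : 0 < p := by linarith
  have hq0 : ENNReal.ofReal p ≠ 0 := by simpa using hp0
  have iA : 0 ≤ ∫ x, ‖A x‖ ^ p := integral_nonneg fun x => by positivity
  have iB : 0 ≤ ∫ x, ‖B x‖ ^ p := integral_nonneg fun x => by positivity
  rw [hA.eLpNorm_eq_integral_rpow_norm hq0 ENNReal.ofReal_ne_top,
    hB.eLpNorm_eq_integral_rpow_norm hq0 ENNReal.ofReal_ne_top,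
    ENNReal.toReal_ofReal hp0.le, ← ENNReal.ofReal_mul hc,
    ENNReal.ofReal_le_ofReal_iff (by positivity)] at h
  have h2 := Real.rpow_le_rpow (by positivity) h hp0.le
  rwa [Real.mul_rpow hc (by positivity), Real.rpow_inv_rpow iA hp0.ne',
    Real.rpow_inv_rpow iB hp0.ne'] at h2

theorem integrable_inner_H {p : ℝ} (hp : 2 ≤ p) {A B : E → E}
    (hA : MemLp A (ENNReal.ofReal p) volume) (hB : MemLp B (ENNReal.ofReal p) volume) :
    Integrable (fun x => inner ℝ (H (p - 1) (A x)) (B x)) volume := by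
  refine ((integrable_norm_rpow hp hA).add (integrable_norm_rpow hp hB)).mono'
    (((measurable_H _).comp_aemeasurable hA.1.aemeasurable).aestronglyMeasurable.inner hB.1)
    (Eventually.of_forall fun x => ?_)
  refine (norm_inner_le_norm _ _).trans ?_
  have h := rpow_mul_rpow_le_add (r := p - 1) (s := 1) (norm_nonneg (A x)) (norm_nonneg (B x))
    (by linarith) (by norm_num) (by linarith)
  rw [Real.rpow_one, sub_add_cancel] at h
  refine le_trans ?_ h
  gcongr
  exact norm_H_le (by linarith) _

theorem integrable_mul_of_growth {p : ℝ} (hp : 2 ≤ p) {K : Set (EuclideanSpace ℝ (Fin n))}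
    (hK : IsCompact K) {F g ψ : E → ℝ} (hF : AEStronglyMeasurable F volume)
    (hg : MemLp g (ENNReal.ofReal p) volume) (hψ : MemLp ψ (ENNReal.ofReal p) volume)
    (hψK : ∀ x ∉ K, ψ x = 0) {a b : ℝ} (hFg : ∀ x ∈ K, |F x| ≤ a + b * |g x|) :
    Integrable (fun x => F x * ψ x) volume := by
  have i1 : Integrable (K.indicator fun _ => a ^ 2 + b ^ 2 + 1) volume :=
    (integrable_indicator_iff hK.measurableSet).2 (integrableOn_const hK.measure_lt_top.ne)
  refine ((i1.add ((integrable_norm_rpow hp hg).const_mul (b ^ 2))).add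
    (integrable_norm_rpow hp hψ)).mono' (hF.mul hψ.1) (Eventually.of_forall fun x => ?_)
  simp only [Pi.add_apply, Real.norm_eq_abs]
  by_cases hx : x ∈ K
  · rw [Set.indicator_of_mem hx, abs_mul]
    have h1 := hFg x hx
    have h2 := sq_le_one_add_rpow (abs_nonneg (g x)) hp
    have h3 := sq_le_one_add_rpow (abs_nonneg (ψ x)) hp
    have h4 : |F x| * |ψ x| ≤ (a + b * |g x|) * |ψ x| := by gcongr
    have h5 : b ^ 2 * |g x| ^ 2 ≤ b ^ 2 * (1 + |g x| ^ p) := by gcongr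
    nlinarith [sq_nonneg (a - |ψ x|), sq_nonneg (b * |g x| - |ψ x|), sq_nonneg a,
      sq_nonneg (b * |g x|)]
  · rw [Set.indicator_of_notMem hx, hψK x hx]
    simp
    positivity

/-! ### The L² estimate for differences of H_{p/2}(G). -/

/-- Subtracting the equation from its translate. -/
theorem integral_inner_sub_eq {p : ℝ} (hp : 2 ≤ p) {U K : Set (EuclideanSpace ℝ (Fin n))}
    (hK : IsCompact K)
    {g F : E → ℝ} {G : E → E} (hg : HasSobolevGradientZero Set.univ (ENNReal.ofReal p) g G)
    (hFm : AEStronglyMeasurable F volume) {L : ℝ}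
    (hF : ∀ x y, |F x - F y| ≤ L * (‖x - y‖ + |g x - g y|))
    (heq : ∀ ψ Dψ, HasSobolevGradientZero U (ENNReal.ofReal p) ψ Dψ →
      ∫ x, inner ℝ (H (p - 1) (G x)) (Dψ x) = ∫ x, F x * ψ x)
    {ψ : E → ℝ} {Dψ : E → E} (v : E) (hψ : HasSobolevGradientZero U (ENNReal.ofReal p) ψ Dψ)
    (hψv : HasSobolevGradientZero U (ENNReal.ofReal p) (fun x => ψ (x - v)) (fun x => Dψ (x - v)))
    (hψK : ∀ x ∉ K, ψ x = 0) :
    Integrable (fun x => inner ℝ (H (p - 1) (G (x + v)) - H (p - 1) (G x)) (Dψ x)) volume ∧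
    Integrable (fun x => (F (x + v) - F x) * ψ x) volume ∧
    ∫ x, inner ℝ (H (p - 1) (G (x + v)) - H (p - 1) (G x)) (Dψ x) =
      ∫ x, (F (x + v) - F x) * ψ x := by
  have hm : MeasurePreserving (fun x : E => x + v) volume volume := measurePreserving_add_right _ v
  have h1 := heq _ _ hψ
  have h2 := heq _ _ hψv
  -- The equation tested with ψ(· - v) becomes, after x ↦ x + v, the translated equation tested with
  -- ψ.
  rw [← integral_add_right_eq_self _ v, ← integral_add_right_eq_self (fun x => F x * _) v] at h2
  simp only [add_sub_cancel_right] at h2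
  have hGv : MemLp (fun x => G (x + v)) (ENNReal.ofReal p) volume :=
    hg.memLp_gradient.comp_measurePreserving hm
  have hgv : MemLp (fun x => g (x + v)) (ENNReal.ofReal p) volume :=
    hg.memLp.comp_measurePreserving hm
  have i1 := integrable_inner_H hp hGv hψ.memLp_gradient
  have i2 := integrable_inner_H hp hg.memLp_gradient hψ.memLp_gradient
  obtain ⟨R, hR⟩ := hK.isBounded.exists_norm_le
  have hgrow : ∀ x, |F x| ≤ |F 0| + |L| * (‖x‖ + |g x| + |g 0|) := by
    intro x
    have h3 := hF x 0
    rw [sub_zero] at h3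
    have h4 : |F x| ≤ |F 0| + |F x - F 0| := by
      have := abs_add_le (F 0) (F x - F 0)
      rwa [add_sub_cancel] at this
    have h5 : L * (‖x‖ + |g x - g 0|) ≤ |L| * (‖x‖ + |g x| + |g 0|) := by
      refine (mul_le_mul_of_nonneg_right (le_abs_self L) (by positivity)).trans
        (mul_le_mul_of_nonneg_left ?_ (abs_nonneg L))
      rw [add_assoc]
      exact add_le_add_right (abs_sub _ _) _
    linarith
  have i3 : Integrable (fun x => F x * ψ x) volume := by
    refine integrable_mul_of_growth hp hK hFm hg.memLp hψ.memLp hψK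
      (a := |F 0| + |L| * (R + |g 0|)) (b := |L|) fun x hx => (hgrow x).trans ?_
    have : |L| * ‖x‖ ≤ |L| * R := by
      gcongr
      exact hR x hx
    linarith
  have i4 : Integrable (fun x => F (x + v) * ψ x) volume := by
    refine integrable_mul_of_growth hp hK (hFm.comp_measurePreserving hm) hgv hψ.memLp hψK
      (a := |F 0| + |L| * (R + ‖v‖ + |g 0|)) (b := |L|) fun x hx => (hgrow _).trans ?_
    have : |L| * ‖x + v‖ ≤ |L| * (R + ‖v‖) := by
      gcongr
      exact (norm_add_le _ _).trans (by gcongr; exact hR x hx)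
    linarith
  simp only [inner_sub_left, sub_mul]
  exact ⟨i1.sub i2, i4.sub i3, by rw [integral_sub i1 i2, integral_sub i4 i3, h1, h2]⟩

/-- Used with a = |d| and t = |v|: the factor t² is extracted, leaving the difference quotient a/t
in the power p that the Sobolev bound controls. -/
theorem sq_mul_max_rpow_le {a b c t p : ℝ} (ha : 0 ≤ a) (hb : 0 ≤ b) (hc : 0 ≤ c) (ht : 0 < t)
    (hp : 2 ≤ p) : a ^ 2 * (max b c) ^ (p - 2) ≤ t ^ 2 * ((a / t) ^ p + (b ^ p + c ^ p)) := by
  have h1 := sq_mul_rpow_le (a := a / t) (b := max b c) (by positivity) (by positivity) hp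
  have h2 := max_rpow_le_add (p := p) hb hc
  have h3 : a ^ 2 * (max b c) ^ (p - 2) = t ^ 2 * ((a / t) ^ 2 * (max b c) ^ (p - 2)) := by
    field_simp
  rw [h3]
  gcongr
  linarith

theorem add_mul_self_le {a t p : ℝ} (ha : 0 ≤ a) (ht : 0 < t) (hp : 2 ≤ p) :
    (t + a) * a ≤ t ^ 2 * (2 + 2 * (a / t) ^ p) := by
  have h1 := sq_le_one_add_rpow (a := a / t) (by positivity) hp
  have h2 := le_one_add_rpow (a := a / t) (by positivity) hp
  have h3 : (t + a) * a = t ^ 2 * (a / t + (a / t) ^ 2) := by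
    field_simp
  rw [h3]
  exact mul_le_mul_of_nonneg_left (by linarith) (by positivity)

/-- The difference quotients of `H_{p/2}(Du)` are locally bounded in `L²`. -/
theorem exists_integral_sq_H_translate_sub_le {p : ℝ} (hp : 2 ≤ p)
    {U : Set (EuclideanSpace ℝ (Fin n))} (hU : IsOpen U)
    {g F : E → ℝ} {G : E → E} (hg : HasSobolevGradientZero Set.univ (ENNReal.ofReal p) g G)
    (hFm : AEStronglyMeasurable F volume) {L : ℝ} (hL : 0 ≤ L)
    (hF : ∀ x y, |F x - F y| ≤ L * (‖x - y‖ + |g x - g y|))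
    (heq : ∀ ψ Dψ, HasSobolevGradientZero U (ENNReal.ofReal p) ψ Dψ →
      ∫ x, inner ℝ (H (p - 1) (G x)) (Dψ x) = ∫ x, F x * ψ x)
    {η : E → ℝ} (hη : IsTestFunction U η) :
    ∃ C : ℝ, 0 ≤ C ∧ ∃ δ : ℝ, 0 < δ ∧ ∀ v : E, ‖v‖ < δ →
      ∫ x, η x ^ 2 * ‖H (p / 2) (G (x + v)) - H (p / 2) (G x)‖ ^ 2 ≤ C * ‖v‖ ^ 2 := by
  have hp0 : 0 < p := by linarith
  have hq : 1 ≤ ENNReal.ofReal p := by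
    rw [ENNReal.one_le_ofReal]
    linarith
  have hq' : ENNReal.ofReal p ≠ ⊤ := ENNReal.ofReal_ne_top
  -- For |v| < δ the translated cutoff is still supported in U, so both test functions are
  -- admissible.
  obtain ⟨δ, hδ, hδU⟩ := hη.2.1.isCompact.exists_thickening_subset_open hU hη.2.2
  obtain ⟨B, hB0, hB⟩ := hη.exists_bound
  set A := ∫ x, ‖G x‖ ^ p with hA
  have hA0 : 0 ≤ A := integral_nonneg fun x => by positivity
  set m := volume.real (tsupport η)
  -- The first summand comes from the right-hand side of the equation. In the second, from ∇η, the
  -- three copies of A bound the p-th power integrals of d/|v|, G(· + v) and G.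
  refine ⟨p ^ 2 * (L * B ^ 2 * (2 * m + 2 * A)) + 4 * p ^ 4 * (B ^ 2 * (A + (A + A))),
    by positivity, δ, hδ, fun v hv => ?_⟩
  rcases eq_or_ne v 0 with rfl | hv0
  · simp
  set t := ‖v‖
  have ht : 0 < t := norm_pos_iff.2 hv0
  have hm : MeasurePreserving (fun x : E => x + v) volume volume := measurePreserving_add_right _ v
  set d : E → ℝ := fun x => g (x + v) - g x with hd
  have hη2 : IsTestFunction U (fun x => η x * η x) := hη.mul_left hη.1
  have hgrad2 : ∀ x, ∇ (fun x => η x * η x) x = (2 * η x) • ∇ η x := by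
    intro x
    rw [gradient_mul (hη.differentiable _) (hη.differentiable _)]
    module
  have hηv : IsTestFunction U (fun x => η (x + -v) * η (x + -v)) := by
    refine hη2.comp_add_right fun x hx => hδU ?_
    have hx' : x + -v ∈ tsupport η := tsupport_mul_subset_left hx
    exact Metric.mem_thickening_iff.2 ⟨_, hx', by simpa using hv⟩
  have hdS := (hg.comp_add_right v).sub hq hg
  have hψ := hdS.mul_testFunction hq hη2
  -- The translate ψ(x - v) equals η²(x - v)(g(x) - g(x - v)), again a cutoff times a difference of
  -- Sobolev functions.
  have hψv := (hg.sub hq (hg.comp_add_right (-v))).mul_testFunction hq hηv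
  set Dψ : E → E := fun x => (η x * η x) • (G (x + v) - G x) +
    (g (x + v) - g x) • ∇ (fun x => η x * η x) x with hDψ
  have hψv' : HasSobolevGradientZero U (ENNReal.ofReal p)
      (fun x => (fun x => η x * η x * d x) (x - v)) (fun x => Dψ (x - v)) := by
    convert hψv using 2 with x x
    · simp [hd, sub_eq_add_neg]
    · rw [gradient_comp_add_right (fun x => η x * η x)]
      simp [hDψ, sub_eq_add_neg]
  obtain ⟨i1, i2, e1⟩ := integral_inner_sub_eq hp hη.2.1 hg hFm hF heq v hψ hψv'
    (fun x hx => by simp [image_eq_zero_of_notMem_tsupport hx])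
  have hdp : Integrable (fun x => (|d x| / t) ^ p) volume := by
    have := (integrable_norm_rpow hp hdS.memLp).div_const (t ^ p)
    refine this.congr (Eventually.of_forall fun x => ?_)
    simp only [Real.norm_eq_abs]
    rw [Real.div_rpow (abs_nonneg _) ht.le]
  have hdA : ∫ x, (|d x| / t) ^ p ≤ A := by
    have h1 := integral_norm_rpow_le hp hdS.memLp hg.memLp_gradient ht.le
      (hg.eLpNorm_translate_sub_le hq hq' v)
    have h2 : ∫ x, (|d x| / t) ^ p = (∫ x, |d x| ^ p) / t ^ p := by
      rw [← integral_div]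
      refine integral_congr_ae (Eventually.of_forall fun x => ?_)
      exact Real.div_rpow (abs_nonneg _) ht.le _
    rw [h2, div_le_iff₀ (by positivity), mul_comm]
    exact h1
  have hGp := integrable_norm_rpow hp hg.memLp_gradient
  have hGvp : Integrable (fun x => ‖G (x + v)‖ ^ p) volume :=
    hm.integrable_comp_of_integrable (g := fun x => ‖G x‖ ^ p) hGp
  have hGvA : ∫ x, ‖G (x + v)‖ ^ p = A :=
    integral_add_right_eq_self (fun x => ‖G x‖ ^ p) v
  have hK : Integrable ((tsupport η).indicator fun _ => (2 : ℝ)) volume :=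
    (integrable_indicator_iff (isClosed_tsupport η).measurableSet).2
      (integrableOn_const hη.2.1.measure_lt_top.ne)
  have hKm : ∫ x, (tsupport η).indicator (fun _ => (2 : ℝ)) x = 2 * m := by
    rw [integral_indicator_const _ (isClosed_tsupport η).measurableSet, smul_eq_mul, mul_comm]
  -- the right-hand side of the equation
  have hrhs : ∫ x, (F (x + v) - F x) * (η x * η x * d x) ≤
      t ^ 2 * (L * B ^ 2 * (2 * m + 2 * A)) := by
    calc _ ≤ ∫ x, t ^ 2 * (L * B ^ 2 *
          ((tsupport η).indicator (fun _ => (2 : ℝ)) x + 2 * (|d x| / t) ^ p)) := by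
          refine integral_mono i2
            (((hK.add (hdp.const_mul 2)).const_mul (L * B ^ 2)).const_mul (t ^ 2)) fun x => ?_
          refine (le_abs_self _).trans ?_
          by_cases hx : x ∈ tsupport η
          · simp only [Set.indicator_of_mem hx, abs_mul]
            have h1 : |F (x + v) - F x| ≤ L * (t + |d x|) := by
              have := hF (x + v) x
              rwa [add_sub_cancel_left] at this
            have h2 : |η x| ≤ B := (hB x).1
            have h3 := add_mul_self_le (abs_nonneg (d x)) ht hp
            calc _ ≤ L * (t + |d x|) * (B * B * |d x|) := by gcongr
              _ = L * B ^ 2 * ((t + |d x|) * |d x|) := by ring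
              _ ≤ L * B ^ 2 * (t ^ 2 * (2 + 2 * (|d x| / t) ^ p)) := by gcongr
              _ = _ := by ring
          · rw [image_eq_zero_of_notMem_tsupport hx, Set.indicator_of_notMem hx]
            simp only [zero_mul, mul_zero, abs_zero]
            positivity
      _ ≤ _ := by
          rw [integral_const_mul, integral_const_mul, integral_add hK (hdp.const_mul 2),
            integral_const_mul, hKm]
          gcongr
  have i5 : Integrable (fun x => ‖G (x + v)‖ ^ p + ‖G x‖ ^ p) volume := hGvp.add hGp
  have i6 : Integrable (fun x => 4 * p ^ 4 * (t ^ 2 * (B ^ 2 *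
      ((|d x| / t) ^ p + (‖G (x + v)‖ ^ p + ‖G x‖ ^ p))))) volume :=
    (((hdp.add i5).const_mul (B ^ 2)).const_mul (t ^ 2)).const_mul _
  calc _ ≤ ∫ x, (p ^ 2 * inner ℝ (H (p - 1) (G (x + v)) - H (p - 1) (G x)) (Dψ x) +
        4 * p ^ 4 * (t ^ 2 * (B ^ 2 * ((|d x| / t) ^ p + (‖G (x + v)‖ ^ p + ‖G x‖ ^ p))))) := by
        refine integral_mono_of_nonneg (Eventually.of_forall fun x => by positivity)
          ((i1.const_mul _).add i6) (Eventually.of_forall fun x => ?_)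
        have h1 := sq_mul_norm_H_sub_sq_le hp (G (x + v)) (G x) (∇ η x) (η x) (d x)
        have h2 : η x ^ 2 • (G (x + v) - G x) + (2 * η x * d x) • ∇ η x = Dψ x := by
          simp only [hDψ, hgrad2, hd]
          module
        rw [h2] at h1
        refine h1.trans ?_
        have h3 := sq_mul_max_rpow_le (abs_nonneg (d x)) (norm_nonneg (G (x + v)))
          (norm_nonneg (G x)) ht hp
        rw [sq_abs] at h3
        have h4 : ‖∇ η x‖ ≤ B := (hB x).2
        refine add_le_add le_rfl (mul_le_mul_of_nonneg_left ?_ (by positivity))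
        calc _ = ‖∇ η x‖ ^ 2 * (d x ^ 2 * (max ‖G (x + v)‖ ‖G x‖) ^ (p - 2)) := by ring
          _ ≤ B ^ 2 * (t ^ 2 * ((|d x| / t) ^ p + (‖G (x + v)‖ ^ p + ‖G x‖ ^ p))) := by gcongr
          _ = _ := by ring
    _ = p ^ 2 * (∫ x, (F (x + v) - F x) * (η x * η x * d x)) +
        4 * p ^ 4 * (t ^ 2 * (B ^ 2 * ((∫ x, (|d x| / t) ^ p) + (A + A)))) := by
        rw [integral_add (i1.const_mul _) i6, integral_const_mul, integral_const_mul,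
            integral_const_mul, integral_const_mul, integral_add hdp i5, integral_add hGvp hGp, hGvA, ← hA,
            e1]
    _ ≤ p ^ 2 * (t ^ 2 * (L * B ^ 2 * (2 * m + 2 * A))) +
        4 * p ^ 4 * (t ^ 2 * (B ^ 2 * (A + (A + A)))) := by
        gcongr
    _ = _ := by ring

/-! ### From difference quotients to weak derivatives. -/

/-- A linear functional that is bounded with respect to the seminorm `‖A ·‖` is represented by a
vector of the Hilbert space. -/
theorem exists_forall_eq_inner_of_bound {V X : Type*} [AddCommGroup V] [Module ℝ V]
    [NormedAddCommGroup X] [InnerProductSpace ℝ X] [CompleteSpace X] (A : V →ₗ[ℝ] X)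
    (ℓ : V →ₗ[ℝ] ℝ) (C : ℝ) (h : ∀ v, |ℓ v| ≤ C * ‖A v‖) :
    ∃ w : X, ∀ v, ℓ v = inner ℝ w (A v) := by
  -- A linear section of A moves ℓ to the range of A, where it is bounded; Hahn–Banach and Riesz
  -- then give the vector.
  obtain ⟨s, hs⟩ := A.rangeRestrict.exists_rightInverse_of_surjective A.range_rangeRestrict
  have hs' : ∀ y, A (s y) = y := fun y => by
    have := congrArg (fun f => ((f y : LinearMap.range A) : X)) hs
    simpa using this
  let m : StrongDual ℝ (LinearMap.range A) := (ℓ ∘ₗ s).mkContinuous C fun y => by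
    have := h (s y)
    rwa [hs'] at this
  obtain ⟨M, hM, -⟩ := exists_extension_norm_eq (LinearMap.range A) m
  refine ⟨(InnerProductSpace.toDual ℝ X).symm M, fun v => ?_⟩
  rw [InnerProductSpace.toDual_symm_apply]
  have h1 : M (A v) = ℓ (s ⟨A v, LinearMap.mem_range_self A v⟩) :=
    hM ⟨A v, LinearMap.mem_range_self A v⟩
  -- This vector lies in the kernel of A, where the bound forces ℓ to vanish; so the choice of
  -- section is immaterial.
  have h2 := h (v - s ⟨A v, LinearMap.mem_range_self A v⟩)
  rw [map_sub, map_sub, hs', sub_self, norm_zero, mul_zero] at h2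
  rw [h1]
  linarith [abs_nonpos_iff.1 h2]

theorem isTestFunction_zero (U : Set (EuclideanSpace ℝ (Fin n))) :
    IsTestFunction U (0 : E → ℝ) :=
  ⟨contDiff_const, HasCompactSupport.zero, by simp [tsupport]⟩

/-- The test functions in `U`, as a real vector space. -/
def testFunctions (U : Set (EuclideanSpace ℝ (Fin n))) :
    Submodule ℝ (EuclideanSpace ℝ (Fin n) → ℝ) where
  carrier := {φ | IsTestFunction U φ}
  zero_mem' := isTestFunction_zero U
  add_mem' := fun {φ ψ} hφ hψ => ⟨hφ.1.add hψ.1, hφ.2.1.add hψ.2.1,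
    (tsupport_add φ ψ).trans (Set.union_subset hφ.2.2 hψ.2.2)⟩
  smul_mem' := fun c φ hφ => by
    have h : IsTestFunction U (fun x => φ x * c) := hφ.mul_left contDiff_const
    have e : c • φ = fun x => φ x * c := by
      ext x
      simp [mul_comm]
    change IsTestFunction U (c • φ)
    rwa [e]

theorem exists_isTestFunction_eq_one {K U : Set (EuclideanSpace ℝ (Fin n))} (hU : IsOpen U)
    (hK : IsCompact K) (hKU : K ⊆ U) : ∃ η : E → ℝ, IsTestFunction U η ∧ ∀ x ∈ K, η x = 1 := by
  obtain ⟨V, hV, hKV⟩ := exists_compactlyIncluded_superset hU hK hKU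
  obtain ⟨f, h0, h1, -⟩ := exists_contMDiffMap_zero_one_of_isClosed (n := ⊤)
    (modelWithCornersSelf ℝ (EuclideanSpace ℝ (Fin n)))
    hV.1.isClosed_compl hK.isClosed (Set.disjoint_compl_left_iff_subset.2 hKV)
  have hs : tsupport f ⊆ closure V := by
    refine closure_mono fun x hx => ?_
    by_contra h
    exact hx (h0 h)
  exact ⟨f, ⟨f.contMDiff.contDiff, hV.2.1.of_isClosed_subset (isClosed_tsupport _) hs,
    hs.trans hV.2.2⟩, fun x hx => h1 hx⟩

theorem norm_toLp_sq {f : E → ℝ} (hf : MemLp f 2 volume) : ‖hf.toLp f‖ ^ 2 = ∫ x, f x ^ 2 := by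
  rw [← real_inner_self_eq_norm_sq, L2.inner_def]
  refine integral_congr_ae ?_
  filter_upwards [hf.coeFn_toLp] with x hx
  rw [hx]
  simp [sq]

theorem inner_toLp_right (w : Lp ℝ 2 (volume : Measure E)) {f : E → ℝ} (hf : MemLp f 2 volume) :
    inner ℝ w (hf.toLp f) = ∫ x, w x * f x := by
  rw [L2.inner_def]
  refine integral_congr_ae ?_
  filter_upwards [hf.coeFn_toLp] with x hx
  rw [hx]
  simp [mul_comm]

theorem abs_integral_mul_le {f g : E → ℝ} (hf : MemLp f 2 volume) (hg : MemLp g 2 volume) :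
    |∫ x, f x * g x| ≤ ‖hf.toLp f‖ * ‖hg.toLp g‖ := by
  have h : ∫ x, f x * g x = inner ℝ (hf.toLp f) (hg.toLp g) := by
    rw [inner_toLp_right]
    refine integral_congr_ae ?_
    filter_upwards [hf.coeFn_toLp] with x hx
    rw [hx]
  rw [h]
  exact abs_real_inner_le_norm _ _

/-- Difference quotients of test functions converge to partial derivatives weakly. -/
theorem tendsto_integral_mul_difference_quotient {U : Set (EuclideanSpace ℝ (Fin n))} {w φ : E → ℝ}
    (hw : LocallyIntegrable w volume) (hφ : IsTestFunction U φ) (i : Fin n) :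
    Tendsto (fun t : ℝ => ∫ x, w x *
      (t⁻¹ * (φ (x - t • EuclideanSpace.single i 1) - φ x))) (𝓝[>] 0)
      (𝓝 (-∫ x, w x * ∇ φ x i)) := by
  set e : E := EuclideanSpace.single i 1 with he
  have hen : ‖e‖ = 1 := by simp [he]
  obtain ⟨M, hM⟩ := hφ.1.lipschitzWith_of_hasCompactSupport hφ.2.1 (by simp)
  have hK : IsCompact (Metric.cthickening 1 (tsupport φ)) := hφ.2.1.isCompact.cthickening
  rw [← integral_neg]
  refine tendsto_integral_filter_of_dominated_convergence
    -- For 0 < t < 1 the quotient is bounded by the Lipschitz constant of φ and vanishes outside the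
    -- closed 1-thickening of its support.
    ((Metric.cthickening 1 (tsupport φ)).indicator fun x => M * |w x|) ?_ ?_ ?_ ?_
  · refine Eventually.of_forall fun t => hw.aestronglyMeasurable.mul ?_
    refine Continuous.aestronglyMeasurable ?_
    have := hφ.continuous
    fun_prop
  · have hev : ∀ᶠ t : ℝ in 𝓝[>] 0, t ∈ Set.Ioo (0 : ℝ) 1 := Ioo_mem_nhdsGT one_pos
    filter_upwards [hev] with t ht
    refine Eventually.of_forall fun x => ?_
    by_cases hx : x ∈ Metric.cthickening 1 (tsupport φ)
    · rw [Set.indicator_of_mem hx, norm_mul, norm_mul, norm_inv, Real.norm_of_nonneg ht.1.le,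
        mul_comm, Real.norm_eq_abs (w x)]
      gcongr
      have h1 := hM.dist_le_mul (x - t • e) x
      rw [dist_eq_norm, dist_eq_norm, sub_sub_cancel_left, norm_neg, norm_smul, hen, mul_one,
        Real.norm_of_nonneg ht.1.le] at h1
      rwa [inv_mul_le_iff₀ ht.1, mul_comm]
    · have h1 : x ∉ tsupport φ := fun h => hx (Metric.self_subset_cthickening _ h)
      have h2 : x - t • e ∉ tsupport φ := fun h => hx <| by
        refine Metric.mem_cthickening_of_dist_le x _ _ _ h ?_
        rw [dist_eq_norm, sub_sub_cancel, norm_smul, hen, mul_one, Real.norm_of_nonneg ht.1.le]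
        exact ht.2.le
      rw [Set.indicator_of_notMem hx, image_eq_zero_of_notMem_tsupport h1,
        image_eq_zero_of_notMem_tsupport h2]
      simp
  · rw [integrable_indicator_iff hK.measurableSet]
    exact ((hw.integrableOn_isCompact hK).abs).const_mul _
  · refine Eventually.of_forall fun x => ?_
    rw [← mul_neg]
    refine Tendsto.const_mul _ ?_
    have h1 : HasDerivAt (fun t : ℝ => φ (x - t • e)) (-(∇ φ x i)) 0 := by
      have h2 : HasDerivAt (fun t : ℝ => x - t • e) (-e) 0 := by
        simpa using ((hasDerivAt_id (0 : ℝ)).smul_const e).const_sub x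
      have h3 : HasFDerivAt φ (fderiv ℝ φ x) (x - (0 : ℝ) • e) := by
        simpa using (hφ.differentiable x).hasFDerivAt
      have h4 := h3.comp_hasDerivAt (0 : ℝ) h2
      rw [map_neg] at h4
      rw [gradient_apply]
      exact h4
    have h5 := h1.tendsto_slope_zero_right
    simpa using h5

/-- A function whose difference quotients are locally bounded in `L²` has a weak partial derivative
in `L²`. -/
theorem exists_weak_partial_of_difference_quotient {U U' : Set (EuclideanSpace ℝ (Fin n))}
    {w η : E → ℝ} (hw : MemLp w 2 volume) (hη : IsTestFunction U' η) (hηU : ∀ x ∈ U, η x = 1)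
    {C δ : ℝ} (hδ : 0 < δ)
    (hC : ∀ v : E, ‖v‖ < δ → ∫ x, η x ^ 2 * (w (x + v) - w x) ^ 2 ≤ C * ‖v‖ ^ 2) (i : Fin n) :
    ∃ W : E → ℝ, MemLp W 2 volume ∧ ∀ φ, IsTestFunction U φ →
      ∫ x, w x * ∇ φ x i = -∫ x, W x * φ x := by
  have hwl : LocallyIntegrable w volume := hw.locallyIntegrable (by norm_num)
  obtain ⟨B, -, hB⟩ := hη.exists_bound
  have hbound : ∀ φ, ∀ hφ : IsTestFunction U φ,
      |∫ x, w x * ∇ φ x i| ≤ √C * ‖(hφ.memLp 2).toLp φ‖ := by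
    intro φ hφ
    have hlim := (tendsto_integral_mul_difference_quotient hwl hφ i).abs
    rw [abs_neg] at hlim
    refine le_of_tendsto hlim ?_
    have hev : ∀ᶠ t : ℝ in 𝓝[>] 0, t ∈ Set.Ioo (0 : ℝ) δ := Ioo_mem_nhdsGT hδ
    filter_upwards [hev] with t ht
    set v : E := t • EuclideanSpace.single i 1 with hv
    have hvn : ‖v‖ = t := by simp [hv, norm_smul, abs_of_pos ht.1]
    have hm : MeasurePreserving (fun x : E => x + v) volume volume :=
      measurePreserving_add_right _ v
    have hwv : MemLp (fun x => w (x + v)) 2 volume := hw.comp_measurePreserving hm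
    have hd : MemLp (fun x => η x * (w (x + v) - w x)) 2 volume :=
      (hwv.sub hw).of_le_mul (c := B) (hη.continuous.aestronglyMeasurable.mul (hwv.sub hw).1)
        (Eventually.of_forall fun x => by
          rw [norm_mul]
          exact mul_le_mul_of_nonneg_right (hB x).1 (norm_nonneg _))
    have i1 : Integrable (fun x => w x * φ (x - v)) volume := by
      have := hw.integrable_mul
        ((hφ.memLp 2).comp_measurePreserving (measurePreserving_sub_right volume v))
      exact this
    have i2 : Integrable (fun x => w x * φ x) volume := hw.integrable_mul (hφ.memLp 2)
    have i3 : Integrable (fun x => w (x + v) * φ x) volume := hwv.integrable_mul (hφ.memLp 2)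
    -- Discrete integration by parts. The factor η can be inserted because it equals 1 wherever φ is
    -- nonzero.
    have e1 : ∫ x, w x * (t⁻¹ * (φ (x - v) - φ x)) =
        t⁻¹ * ∫ x, η x * (w (x + v) - w x) * φ x := by
      have e2 : ∫ x, w x * φ (x - v) = ∫ x, w (x + v) * φ x := by
        rw [← integral_add_right_eq_self _ v]
        simp
      have e3 : ∀ x, η x * (w (x + v) - w x) * φ x = w (x + v) * φ x - w x * φ x := by
        intro x
        by_cases hx : x ∈ U
        · rw [hηU x hx]
          ring
        · rw [hφ.eq_zero_of_notMem hx]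
          ring
      have e4 : ∀ x, w x * (t⁻¹ * (φ (x - v) - φ x)) =
          t⁻¹ * (w x * φ (x - v) - w x * φ x) := fun x => by ring
      simp_rw [e3, e4]
      rw [integral_const_mul, integral_sub i1 i2, integral_sub i3 i2, e2]
    rw [e1, abs_mul, abs_of_pos (inv_pos.2 ht.1), inv_mul_le_iff₀ ht.1]
    refine (abs_integral_mul_le hd (hφ.memLp 2)).trans ?_
    rw [← mul_assoc]
    gcongr
    have h1 := hC v (by rw [hvn]; exact ht.2)
    have h2 : ‖hd.toLp _‖ ^ 2 ≤ C * t ^ 2 := by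
      rw [norm_toLp_sq, ← hvn]
      simpa only [mul_pow] using h1
    have h3 := Real.sqrt_le_sqrt h2
    rwa [Real.sqrt_sq (norm_nonneg _), Real.sqrt_mul' _ (sq_nonneg t), Real.sqrt_sq ht.1.le,
      mul_comm] at h3
  let A : testFunctions U →ₗ[ℝ] Lp ℝ 2 (volume : Measure E) :=
    { toFun := fun φ => (IsTestFunction.memLp φ.2 2).toLp φ.1
      map_add' := fun φ ψ => rfl
      map_smul' := fun c φ => rfl }
  have hint : ∀ φ, IsTestFunction U φ → Integrable (fun x => w x * ∇ φ x i) volume := by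
    intro φ hφ
    exact hw.integrable_mul
      ((hφ.memLp_gradient 2).continuousLinearMap_comp (EuclideanSpace.proj i : E →L[ℝ] ℝ))
  let ℓ : testFunctions U →ₗ[ℝ] ℝ :=
    { toFun := fun φ => ∫ x, w x * ∇ φ.1 x i
      map_add' := fun φ ψ => by
        rw [← integral_add (hint _ φ.2) (hint _ ψ.2)]
        congr 1
        ext x
        simp only [gradient_apply, Submodule.coe_add]
        rw [fderiv_add (IsTestFunction.differentiable φ.2 x) (IsTestFunction.differentiable ψ.2 x)]
        simp [mul_add]
      map_smul' := fun c φ => by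
        rw [RingHom.id_apply, smul_eq_mul, ← integral_const_mul]
        congr 1
        ext x
        simp only [gradient_apply, Submodule.coe_smul]
        rw [fderiv_const_smul (IsTestFunction.differentiable φ.2 x)]
        simp [mul_left_comm] }
  obtain ⟨W, hW⟩ := exists_forall_eq_inner_of_bound A ℓ (√C) fun φ => hbound φ.1 φ.2
  refine ⟨fun x => -W x, (Lp.memLp W).neg, fun φ hφ => ?_⟩
  have h1 := hW ⟨φ, hφ⟩
  have h2 : inner ℝ W (A ⟨φ, hφ⟩) = ∫ x, W x * φ x := inner_toLp_right W (hφ.memLp 2)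
  simp only [neg_mul, integral_neg, neg_neg]
  rw [← h2, ← h1]
  rfl

/-! ### Reduction of the local problem to the whole space. -/

theorem ae_eq_zero_of_tendsto_eLpNorm {V : Type*} [NormedAddCommGroup V]
    {U : Set (EuclideanSpace ℝ (Fin n))} (hU : MeasurableSet U) {q : ENNReal} (hq : q ≠ 0)
    {g : E → V} (hg : MemLp g q volume) {ψ : ℕ → E → V} (hψ : ∀ k, ∀ x ∉ U, ψ k x = 0)
    (h : Tendsto (fun k => eLpNorm (fun x => ψ k x - g x) q volume) atTop (𝓝 0)) :
    ∀ᵐ x, x ∉ U → g x = 0 := by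
  have h0 : eLpNorm g q (volume.restrict Uᶜ) = 0 := by
    refine le_antisymm (ge_of_tendsto' h fun k => ?_) zero_le
    refine le_trans (le_of_eq ?_)
      (eLpNorm_mono_measure (fun x => ψ k x - g x) (Measure.restrict_le_self (s := Uᶜ)))
    rw [← eLpNorm_neg]
    refine eLpNorm_congr_ae ?_
    filter_upwards [ae_restrict_mem hU.compl] with x hx
    simp [hψ k x hx]
  rw [eLpNorm_eq_zero_iff hg.1.restrict hq] at h0
  exact (ae_restrict_iff' hU.compl).1 h0

theorem HasSobolevGradientZero.ae_eq_zero {U : Set (EuclideanSpace ℝ (Fin n))} (hU : IsOpen U)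
    {q : ENNReal} (hq : q ≠ 0) {g : E → ℝ} {G : E → E} (h : HasSobolevGradientZero U q g G) :
    (∀ᵐ x, x ∉ U → g x = 0) ∧ ∀ᵐ x, x ∉ U → G x = 0 := by
  obtain ⟨ψ, h1, h2, h3⟩ := h.exists_approx
  exact ⟨ae_eq_zero_of_tendsto_eLpNorm hU.measurableSet hq h.memLp
    (fun k x hx => (h1 k).eq_zero_of_notMem hx) h2,
    ae_eq_zero_of_tendsto_eLpNorm hU.measurableSet hq h.memLp_gradient
    (fun k x hx => (h1 k).gradient_eq_zero_of_notMem hx) h3⟩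

/-- A locally Lipschitz right-hand side extends to a globally Lipschitz function. -/
theorem exists_lipschitz_extension {Ω U : Set (EuclideanSpace ℝ (Fin n))} {f : E → ℝ → ℝ}
    (hF1 : ConditionF1 Ω f) (hF2 : ConditionF2 Ω f) (hU : CompactlyIncluded U Ω) {K : ℝ}
    (hK : 0 < K) : ∃ (L : NNReal) (F : E × ℝ → ℝ), LipschitzWith L F ∧
      ∀ x ∈ U, ∀ s, |s| ≤ K → f x s = F (x, s) := by
  obtain ⟨L, hL, h1⟩ := hF1 U hU K hK
  obtain ⟨M, hM, h2⟩ := hF2 U hU K hK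
  have hlip : LipschitzOnWith ⟨L + M, by positivity⟩ (fun z : E × ℝ => f z.1 z.2)
      (U ×ˢ {s | |s| ≤ K}) := by
    refine LipschitzOnWith.of_dist_le_mul ?_
    rintro ⟨x, s⟩ ⟨hx, hs⟩ ⟨y, t⟩ ⟨hy, ht⟩
    simp only at hx hs hy ht
    have h3 : dist x y ≤ dist (x, s) (y, t) := le_max_left _ _
    have h4 : dist s t ≤ dist (x, s) (y, t) := le_max_right _ _
    have h5 := h1 x hx s t hs ht
    have h6 := h2 x hx y hy t ht
    rw [← Real.dist_eq s t] at h5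
    rw [← dist_eq_norm] at h6
    change |f x s - f y t| ≤ (L + M) * dist (x, s) (y, t)
    calc _ ≤ |f x s - f x t| + |f x t - f y t| := abs_sub_le _ _ _
      _ ≤ L * dist (x, s) (y, t) + M * dist (x, s) (y, t) :=
          add_le_add (h5.trans (by gcongr)) (h6.trans (by gcongr))
      _ = _ := by ring
  -- McShane's extension of a real Lipschitz function from an arbitrary subset.
  obtain ⟨F, hF, hEq⟩ := hlip.extend_real
  exact ⟨_, F, hF, fun x hx s hs => hEq (⟨hx, hs⟩ : (x, s) ∈ U ×ˢ {s | |s| ≤ K})⟩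

theorem memLp_two_H {p : ℝ} (hp : 2 ≤ p) {μ : Measure (EuclideanSpace ℝ (Fin n))} {G : E → E}
    (hG : MemLp G (ENNReal.ofReal p) μ) : MemLp (fun x => H (p / 2) (G x)) 2 μ := by
  have hp0 : 0 < p := by linarith
  have hm : AEStronglyMeasurable (fun x => H (p / 2) (G x)) μ :=
    ((measurable_H _).comp_aemeasurable hG.1.aemeasurable).aestronglyMeasurable
  rw [memLp_two_iff_integrable_sq_norm hm]
  have h1 := hG.integrable_norm_rpow (by simpa using hp0) ENNReal.ofReal_ne_top
  rw [ENNReal.toReal_ofReal hp0.le] at h1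
  refine h1.mono' (hm.norm.pow 2) (Eventually.of_forall fun x => ?_)
  rw [Real.norm_of_nonneg (by positivity)]
  have h2 : ‖G x‖ ^ p = (‖G x‖ ^ (p / 2)) ^ 2 := by
    rw [← Real.rpow_natCast, ← Real.rpow_mul (norm_nonneg _)]
    congr 1
    push_cast
    ring
  rw [h2]
  gcongr
  exact norm_H_le (by linarith) _

/-- Local existence of the weak partial derivatives of `H_{p/2}(Du)`. -/
theorem exists_local_weak_partial {p : ℝ} (hp : 2 ≤ p) {Ω U₀ : Set (EuclideanSpace ℝ (Fin n))}
    (hΩ : IsOpen Ω) {f : E → ℝ → ℝ} (hF1 : ConditionF1 Ω f) (hF2 : ConditionF2 Ω f)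
    {u : E → ℝ} {Du : E → E} (hu : IsLocalWeakSolution Ω p f u Du) (hub : MemLpLoc Ω ⊤ u)
    (hU₀ : CompactlyIncluded U₀ Ω) (j i : Fin n) :
    ∃ W : E → ℝ, MemLp W 2 volume ∧ ∀ φ, IsTestFunction U₀ φ →
      ∫ x in Ω, H (p / 2) (Du x) j * ∇ φ x i = -∫ x, W x * φ x := by
  have hp0 : 0 < p := by linarith
  have hq0 : ENNReal.ofReal p ≠ 0 := by simpa using hp0
  have hq : 1 ≤ ENNReal.ofReal p := by
    rw [ENNReal.one_le_ofReal]
    linarith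
  -- Two cutoffs are nested: η is 1 on the closure of U₀ and supported in U, while ζ is 1 on the
  -- closure of U and supported in Ω. Thus g = ζu agrees with u wherever the equation is tested.
  obtain ⟨U, hU, hU₀U⟩ := exists_compactlyIncluded_superset hΩ hU₀.2.1 hU₀.2.2
  have hUΩ : U ⊆ Ω := subset_closure.trans hU.2.2
  obtain ⟨η, hη, hη1⟩ := exists_isTestFunction_eq_one hU.1 hU₀.2.1 hU₀U
  obtain ⟨ζ, hζ, hζ1⟩ := exists_isTestFunction_eq_one hΩ hU.2.1 hU.2.2
  have hg := hu.1.mul_testFunction hΩ hq ENNReal.ofReal_ne_top hζ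
  set g : E → ℝ := fun x => ζ x * u x
  set G : E → E := fun x => ζ x • Du x + u x • ∇ ζ x with hGdef
  have hgU : ∀ x ∈ U, g x = u x := fun x hx => by simp [g, hζ1 x (subset_closure hx)]
  have hGU : ∀ x ∈ U, G x = Du x := fun x hx => by
    have h1 : ζ =ᶠ[𝓝 x] fun _ => 1 := by
      filter_upwards [hU.1.mem_nhds hx] with y hy using hζ1 y (subset_closure hy)
    simp only [hGdef]
    rw [h1.gradient_eq, gradient_fun_const, hζ1 x (subset_closure hx)]
    simp
  obtain ⟨K, hK, hKu⟩ : ∃ K : ℝ, 0 < K ∧ ∀ᵐ x, x ∈ U → |u x| ≤ K := by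
    have h1 := hub U hU
    refine ⟨(eLpNorm u ⊤ (volume.restrict U)).toReal + 1, by positivity, ?_⟩
    rw [← ae_restrict_iff' hU.1.measurableSet]
    filter_upwards [ae_le_eLpNormEssSup (f := u) (μ := volume.restrict U)] with x hx
    rw [← eLpNorm_exponent_top] at hx
    have h2 := ENNReal.toReal_mono h1.2.ne hx
    simp only [toReal_enorm, Real.norm_eq_abs] at h2
    linarith
  obtain ⟨L, F, hF, hfF⟩ := exists_lipschitz_extension hF1 hF2 hU hK
  have hFlip : ∀ x y, |F (x, g x) - F (y, g y)| ≤ L * (‖x - y‖ + |g x - g y|) := by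
    intro x y
    have h1 := hF.dist_le_mul (x, g x) (y, g y)
    rw [Real.dist_eq] at h1
    refine h1.trans (mul_le_mul_of_nonneg_left ?_ L.2)
    rw [← dist_eq_norm, ← Real.dist_eq]
    exact max_le_add_of_nonneg dist_nonneg dist_nonneg
  have hFm : AEStronglyMeasurable (fun x => F (x, g x)) volume :=
    hF.continuous.comp_aestronglyMeasurable
      (aestronglyMeasurable_id.prodMk hg.memLp.1)
  -- Admissible ψ and Dψ vanish a.e. outside U, and inside U the data g, G, F agree a.e. with u, Du,
  -- f, so the equation carries over.
  have heq : ∀ ψ Dψ, HasSobolevGradientZero U (ENNReal.ofReal p) ψ Dψ →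
      ∫ x, inner ℝ (H (p - 1) (G x)) (Dψ x) = ∫ x, F (x, g x) * ψ x := by
    intro ψ Dψ hψ
    obtain ⟨h1, h2⟩ := hψ.ae_eq_zero hU.1 hq0
    have h3 := hu.2 U hU ψ Dψ hψ
    rw [setIntegral_eq_integral_of_ae_compl_eq_zero,
      setIntegral_eq_integral_of_ae_compl_eq_zero] at h3
    · refine Eq.trans (integral_congr_ae ?_) (h3.trans (integral_congr_ae ?_))
      · filter_upwards [h2] with x hx
        by_cases hxU : x ∈ U
        · rw [hGU x hxU]
        · rw [hx hxU, inner_zero_right, inner_zero_right]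
      · filter_upwards [h1, hKu] with x hx hxK
        by_cases hxU : x ∈ U
        · rw [hgU x hxU, hfF x hxU _ (hxK hxU)]
        · rw [hx hxU, mul_zero, mul_zero]
    · filter_upwards [h1] with x hx hxΩ
      rw [hx fun h => hxΩ (hUΩ h), mul_zero]
    · filter_upwards [h2] with x hx hxΩ
      rw [hx fun h => hxΩ (hUΩ h), inner_zero_right]
  obtain ⟨C, -, δ, hδ, hC⟩ :=
    exists_integral_sq_H_translate_sub_le hp hU.1 hg hFm L.2 hFlip heq hη
  have hHG := memLp_two_H hp hg.memLp_gradient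
  have hw : MemLp (fun x => H (p / 2) (G x) j) 2 volume := hHG.eval_piLp j
  obtain ⟨B, -, hB⟩ := hη.exists_bound
  obtain ⟨W, hW, hWφ⟩ := exists_weak_partial_of_difference_quotient (U := U₀) (C := C) hw hη
    (fun x hx => hη1 x (subset_closure hx)) hδ (fun v hv => by
      refine le_trans ?_ (hC v hv)
      have hm : MeasurePreserving (fun x : E => x + v) volume volume :=
        measurePreserving_add_right _ v
      have h1 : MemLp (fun x => H (p / 2) (G (x + v)) - H (p / 2) (G x)) 2 volume :=
        (hHG.comp_measurePreserving hm).sub hHG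
      have h2 : MemLp (fun x => η x • (H (p / 2) (G (x + v)) - H (p / 2) (G x))) 2 volume :=
        h1.of_le_mul (c := B) (hη.continuous.aestronglyMeasurable.smul h1.1)
          (Eventually.of_forall fun x => by
            rw [norm_smul]
            exact mul_le_mul_of_nonneg_right (hB x).1 (norm_nonneg _))
      have h3 := (memLp_two_iff_integrable_sq_norm h2.1).1 h2
      simp only [norm_smul, mul_pow, Real.norm_eq_abs, sq_abs] at h3
      refine integral_mono_of_nonneg (Eventually.of_forall fun x => by positivity) h3
        (Eventually.of_forall fun x => ?_)
      refine mul_le_mul_of_nonneg_left ?_ (sq_nonneg _)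
      rw [← sq_abs (_ - _), ← PiLp.sub_apply, ← Real.norm_eq_abs]
      gcongr
      exact PiLp.norm_apply_le _ j) i
  refine ⟨W, hW, fun φ hφ => ?_⟩
  rw [← hWφ φ hφ, setIntegral_eq_integral_of_forall_compl_eq_zero]
  · refine integral_congr_ae (Eventually.of_forall fun x => ?_)
    by_cases hx : x ∈ U₀
    · simp only
      rw [hGU x (hU₀U (subset_closure hx))]
    · simp [hφ.gradient_eq_zero_of_notMem hx]
  · intro x hx
    rw [hφ.gradient_eq_zero_of_notMem fun h => hx (hU₀.2.2 (subset_closure h))]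
    simp

/-! ### Exhaustion of Ω and gluing. -/

/-- Countability is the point: local derivatives agree only almost everywhere, so gluing can discard
only countably many null sets. -/
theorem exists_compactlyIncluded_exhaustion {Ω : Set (EuclideanSpace ℝ (Fin n))} (hΩ : IsOpen Ω) :
    ∃ U : ℕ → Set (EuclideanSpace ℝ (Fin n)), (∀ k, CompactlyIncluded (U k) Ω) ∧
      ∀ K, IsCompact K → K ⊆ Ω → ∃ k, K ⊆ U k := by
  have : LocallyCompactSpace Ω := hΩ.locallyCompactSpace
  let K := CompactExhaustion.choice Ω
  refine ⟨fun k => Subtype.val '' interior (K k), fun k => ?_, fun S hS hSΩ => ?_⟩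
  · have hc : IsCompact (Subtype.val '' K k) := (K.isCompact k).image continuous_subtype_val
    have hcl : closure (Subtype.val '' interior (K k)) ⊆ Subtype.val '' K k :=
      closure_minimal (Set.image_mono interior_subset) hc.isClosed
    refine ⟨hΩ.isOpenMap_subtype_val _ isOpen_interior,
      hc.of_isClosed_subset isClosed_closure hcl, hcl.trans ?_⟩
    rintro _ ⟨x, -, rfl⟩
    exact x.2
  · have hS' : IsCompact (Subtype.val ⁻¹' S : Set Ω) := by
      rw [Subtype.isCompact_iff, Subtype.image_preimage_coe, Set.inter_eq_right.2 hSΩ]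
      exact hS
    obtain ⟨k, hk⟩ := K.exists_superset_of_isCompact hS'
    exact ⟨k + 1, fun x hx => ⟨⟨x, hSΩ hx⟩, K.subset_interior_succ k (hk hx), rfl⟩⟩

theorem locallyIntegrableOn_of_memLpLoc {V : Type*} [NormedAddCommGroup V]
    {Ω : Set (EuclideanSpace ℝ (Fin n))} (hΩ : IsOpen Ω) {q : ENNReal} (hq : 1 ≤ q) {w : E → V}
    (hw : MemLpLoc Ω q w) : LocallyIntegrableOn w Ω volume := by
  intro x hx
  obtain ⟨U, hU, hxU⟩ := exists_compactlyIncluded_superset hΩ (isCompact_singleton (x := x))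
    (Set.singleton_subset_iff.2 hx)
  refine ⟨U, mem_nhdsWithin_of_mem_nhds (hU.1.mem_nhds (Set.singleton_subset_iff.1 hxU)), ?_⟩
  have hfin : volume U ≠ ⊤ :=
    ((measure_mono subset_closure).trans_lt hU.2.1.measure_lt_top).ne
  have : IsFiniteMeasure (volume.restrict U) := isFiniteMeasure_restrict.2 hfin
  exact (hw U hU).integrable hq

/-- Locally defined weak partial derivatives glue to a global one. -/
theorem exists_glued_weak_partial {Ω : Set (EuclideanSpace ℝ (Fin n))} {w : E → ℝ} {i : Fin n}
    {U : ℕ → Set (EuclideanSpace ℝ (Fin n))} (hU : ∀ k, CompactlyIncluded (U k) Ω)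
    (hex : ∀ K, IsCompact K → K ⊆ Ω → ∃ k, K ⊆ U k)
    (h : ∀ k, ∃ W : E → ℝ, MemLp W 2 volume ∧ ∀ φ, IsTestFunction (U k) φ →
      ∫ x in Ω, w x * ∇ φ x i = -∫ x, W x * φ x) :
    ∃ W : E → ℝ, MemLpLoc Ω 2 W ∧ ∀ φ, IsTestFunction Ω φ →
      ∫ x in Ω, w x * ∇ φ x i = -∫ x in Ω, W x * φ x := by
  classical
  choose W hW hWφ using h
  -- Uniqueness of weak derivatives on overlaps, by the fundamental lemma of the calculus of
  -- variations.
  have huniq : ∀ k m, ∀ᵐ x, x ∈ U k → x ∈ U m → W k x = W m x := by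
    intro k m
    have hloc : ∀ k, LocallyIntegrable (W k) volume := fun k =>
      (hW k).locallyIntegrable (by norm_num)
    have h1 := ((hU k).1.inter (hU m).1).ae_eq_zero_of_integral_contDiff_smul_eq_zero
      (f := fun x => W k x - W m x) (((hloc k).sub (hloc m)).locallyIntegrableOn _)
      (fun φ h1 h2 h3 => by
        have hφ : IsTestFunction (U k ∩ U m) φ := ⟨h1, h2, h3⟩
        have e1 := hWφ k φ (hφ.mono Set.inter_subset_left)
        have e2 := hWφ m φ (hφ.mono Set.inter_subset_right)
        have i1 : Integrable (fun x => W k x * φ x) volume := (hW k).integrable_mul (hφ.memLp 2)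
        have i2 : Integrable (fun x => W m x * φ x) volume := (hW m).integrable_mul (hφ.memLp 2)
        simp only [smul_eq_mul, mul_comm (φ _), sub_mul]
        rw [integral_sub i1 i2]
        linarith)
    filter_upwards [h1] with x hx hk hm
    exact sub_eq_zero.1 (hx ⟨hk, hm⟩)
  -- The least index selects a value at each point; measurability is never checked directly, but
  -- inherited from a.e. agreement with a single `W m`.
  let V : E → ℝ := fun x => if hx : ∃ k, x ∈ U k then W (Nat.find hx) x else 0
  have hV : ∀ m, ∀ᵐ x, x ∈ U m → V x = W m x := by
    intro m
    filter_upwards [ae_all_iff.2 fun k => huniq k m] with x hx hm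
    have hex : ∃ k, x ∈ U k := ⟨m, hm⟩
    simp only [V, dif_pos hex]
    exact hx _ (Nat.find_spec hex) hm
  refine ⟨V, fun S hS => ?_, fun φ hφ => ?_⟩
  · obtain ⟨m, hm⟩ := hex _ hS.2.1 hS.2.2
    refine (memLp_congr_ae ?_).2 ((hW m).restrict S)
    rw [EventuallyEq, ae_restrict_iff' hS.1.measurableSet]
    filter_upwards [hV m] with x hx hxS
    exact hx (hm (subset_closure hxS))
  · obtain ⟨m, hm⟩ := hex _ hφ.2.1 hφ.2.2
    rw [hWφ m φ ⟨hφ.1, hφ.2.1, hm⟩, setIntegral_eq_integral_of_forall_compl_eq_zero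
      fun x hx => by rw [hφ.eq_zero_of_notMem hx, mul_zero]]
    congr 1
    refine integral_congr_ae ?_
    filter_upwards [hV m] with x hx
    by_cases hxU : x ∈ U m
    · rw [hx hxU]
    · rw [image_eq_zero_of_notMem_tsupport fun h => hxU (hm h), mul_zero, mul_zero]

end WidelyDegenerate

theorem mainTheorem4 (n : ℕ) (hn : 2 ≤ n) (p : ℝ) (hp : 2 ≤ p)
    (Ω : Set (EuclideanSpace ℝ (Fin n))) (hΩ : IsOpen Ω)
    (f : EuclideanSpace ℝ (Fin n) → ℝ → ℝ)
    (hF1 : WidelyDegenerate.ConditionF1 Ω f) (hF2 : WidelyDegenerate.ConditionF2 Ω f)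
    (u : EuclideanSpace ℝ (Fin n) → ℝ)
    (Du : EuclideanSpace ℝ (Fin n) → EuclideanSpace ℝ (Fin n))
    (hu : WidelyDegenerate.IsLocalWeakSolution Ω p f u Du)
    (hu_bdd : WidelyDegenerate.MemLpLoc Ω ⊤ u) :
    WidelyDegenerate.MemW1Loc Ω 2 (fun x => WidelyDegenerate.H (p / 2) (Du x)) := by
  open WidelyDegenerate in
  intro j
  obtain ⟨U, hU, hex⟩ := exists_compactlyIncluded_exhaustion hΩ
  have key := fun i => exists_glued_weak_partial (i := i) hU hex
    fun k => exists_local_weak_partial hp hΩ hF1 hF2 hu hu_bdd (hU k) j i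
  choose W hW hWφ using key
  have hw : MemLpLoc Ω 2 fun x => H (p / 2) (Du x) j := fun S hS =>
    (memLp_two_H hp (hu.1.memLpLoc_gradient S hS)).eval_piLp j
  have hG : MemLpLoc Ω 2 fun x => (WithLp.toLp 2 fun i => W i x : EuclideanSpace ℝ (Fin n)) :=
    fun S hS => MemLp.of_eval_piLp fun i => hW i S hS
  exact ⟨fun x => WithLp.toLp 2 fun i => W i x,
    ⟨locallyIntegrableOn_of_memLpLoc hΩ (by norm_num) hw,
      locallyIntegrableOn_of_memLpLoc hΩ (by norm_num) hG, fun φ hφ i => hWφ i φ hφ⟩, hw, hG⟩
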